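/- **Model.** Fix an integer $m\ge 1$ and reals $\alpha>\frac12$, $\beta\ge 0$, $\Delta>0$, $\delta\in(0,\frac{40}{81})$; put $g=e^{-\alpha\Delta}$, $\eta=\delta^2g^2\alpha$, $\mu=9e^{2\eta/27}/(1-e^{-\eta/27})^2$, and assume $(1-\frac{81}{40}\delta)g^2\alpha>\beta$. For each $j\in\{0,\dots,m\}$ there are $j$-blocks numbered $0,1,2,\dots$ in the order of their mining times $T^j_0=0<T^j_1\le T^j_2\le\cdots\to\infty$. Block $0$ (genesis) is honest; every other $j$-block is honest or adversarial and has a parent $j$-block mined strictly earlier. A $j$-block determines the $j$-blockchain leading to it from genesis; its height is the number of non-genesis blocks in it. The $j$-block $k$ (with all its ancestors) is published at time $P^j_k\in[T^j_k,\infty]$. A $j$-blockchain $b$ is $t$-credible if $P^j_b\le t$ and its height is at least that of every $j$-blockchain published by time $t-\Delta$. An honest $j$-block $k$ is published at time $T^j_k$ and, if not genesis, its parent is $T^j_k$-credible. Adversarial blocks are otherwise arbitrary. For each $j$, the counting process of honest non-genesis $j$-blocks is a homogeneous Poisson process of rate $\alpha$, and for all $0\le s<t$ and integers $n\ge0$ the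 number $Z^j_{s,t}$ of adversarial $j$-blocks mined during $(s,t]$ satisfies $P(Z^j_{s,t}\le n)\ge e^{-\beta(t-s)}\sum_{i=0}^{n}\frac{(\beta(t-s))^i}{i!}$. **Voting.** The $0$-blocks are proposer blocks, the $j$-blocks with $1\le j\le m$ are voter blocks. Let $R_h$ be the time when the first proposer block of height $h$ is published ($\infty$ if there is none). A voter $j$-block $b$ may vote, at each height $\ell$ with $R_\ell<T^j_b$, for one proposer block of height $\ell$, which must be published no later than $b$ is. An honest one votes on every height $\ell\ge1$ with $R_\ell\le T^j_b-\Delta$ on which no ancestor has voted, and only for blocks published by time $R_\ell+\Delta$ (it picks the first one observed). Only the first vote on each height along a voter blockchain counts. A $t$-credible leader sequence is a sequence $(0,b_1,\dots,b_n)$, with $n$ at least the height of every proposer blockchain published by time $t-\Delta$, such that for some choice of one $t$-credible $j$-blockchain for each $j\in\{1,\dots,m\}$, every $b_\ell$ has the most votes from these $m$ blockchains among all proposer blocks of height $\ell$ published by time $t$; ties are broken by a fixed rule that depends only on the set of tied blocks. Its $h$-high prefix is $(0,b_1,\dots,b_h)$. A prefix is permanent after time $t$ if it is a prefix of all $r$-credible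 leader sequences for all $r\ge t$. **Typical events.** An honest $j$-block $k$ is a lagger if it is the only honest $j$-block mined during $[T^j_k-\Delta,T^j_k]$, and a loner if it is the only honest $j$-block mined during $[T^j_k-\Delta,T^j_k+\Delta]$. Let $N^j_{s,t},X^j_{s,t},Y^j_{s,t}$ be the numbers of honest $j$-blocks, laggers and loners mined during $(s,t]$. Let $E^j_{s,t}$ be the event that $(1-\delta)(t-s)\alpha<N^j_{s,t}<(1+\delta)(t-s)\alpha$, $\;X^j_{s,t}>(1-\delta)(t-s)g\alpha$, $\;Y^j_{s,t}>(1-\delta)(t-s)g^2\alpha$ and $Z^j_{s,t}<(t-s)\beta+(t-s)g^2\alpha\delta$, and let $G^j_{s,t}=\bigcap_{a\in[0,s],\,b\in[t,\infty)}E^j_{a,b}$. **Theorem (leader sequence common prefix).** Let $k$ be an integer with $k\ge\frac{160\alpha(1+\Delta)}{\delta}$, let $h\ge1$ be an integer, $t$ a real number, and let $G=\bigcap_{j=1}^m G^j_{t-\frac{k}{2\alpha}+\Delta,\;t-\Delta}$. Consider the condition $$t\ \ge\ R_h+\frac{k}{(1-\frac{41}{40}\delta)(1-g)g\alpha}+\Delta.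 \qquad(*)$$ 1. At every outcome in $G$ at which $(*)$ holds, all $t$-credible leader sequences have height at least $h$ and share the same $h$-high prefix, and this prefix is permanent after time $t$. 2. Consequently there is a measurable event $A\subseteq G$ with $P(A)\ge 1-m\mu e^{-\frac{\eta}{27}\left(\frac{k}{2\alpha}-2\Delta\right)}$ such that, at every outcome in $A$ at which $(*)$ holds, the $h$-high prefix of all $t$-credible leader sequences is common to them and permanent after time $t$. -/

import Mathlib

open MeasureTheory ProbabilityTheory Filter
open scoped NNReal

namespace Prism

/-- One realisation of all the blocks of one category, numbered in the order in which they are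
mined; block `0` is the (honest) genesis block. `T k` is the mining time of block `k`, `P k` is its
publication time (`⊤` if it is never published) and `parent k` is the number of its parent
(irrelevant for `k = 0`). Only finitely many blocks are mined in a bounded time. -/
structure BlockTree where
  T : ℕ → ℝ
  P : ℕ → EReal
  parent : ℕ → ℕ
  honest : ℕ → Prop
  T_zero : T 0 = 0
  T_pos : ∀ k, 0 < k → 0 < T k
  T_mono : Monotone T
  T_tendsto : Tendsto T atTop atTop
  parent_lt : ∀ k, 0 < k → parent k < k
  /-- the parent is mined strictly earlier -/
  T_parent_lt : ∀ k, 0 < k → T (parent k) < T k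
  honest_zero : honest 0
  T_le_P : ∀ k, (T k : EReal) ≤ P k
  /-- A block counts as published once its whole blockchain is, so that the blockchain ending in
  block `k` is published by time `t` if and only if `P k ≤ t`. -/
  P_parent_le : ∀ k, 0 < k → P (parent k) ≤ P k

namespace BlockTree

/-- The height of block `k`: the number of non-genesis blocks on the path from the genesis block to
block `k`. Blockchains are identified with their last block. -/
def height (B : BlockTree) : ℕ → ℕ
  | 0 => 0
  | k + 1 => B.height (B.parent (k + 1)) + 1
termination_by k => k
decreasing_by exact B.parent_lt (k + 1) (Nat.succ_pos k)

/-- Blockchain `b` is `t`-credible: it is published by time `t`, and it is no shorter than any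
blockchain published by time `t - Δ`. -/
def Credible (B : BlockTree) (Δ t : ℝ) (b : ℕ) : Prop :=
  B.P b ≤ (t : EReal) ∧ ∀ k, B.P k ≤ ((t - Δ : ℝ) : EReal) → B.height k ≤ B.height b

/-- Honest blocks are published as soon as they are mined, and an honest non-genesis block `k`
extends a `T k`-credible blockchain. -/
def HonestMining (B : BlockTree) (Δ : ℝ) : Prop :=
  (∀ k, B.honest k → B.P k = (B.T k : EReal)) ∧
  ∀ k, 0 < k → B.honest k → B.Credible Δ (B.T k) (B.parent k)

/-- `R_h`: the time when the first block of height `h` is published (`⊤` if there is none). -/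
noncomputable def firstPublication (B : BlockTree) (h : ℕ) : EReal :=
  ⨅ (k : ℕ) (_ : B.height k = h), B.P k

/-- The number of honest blocks mined during `(s, t]`. -/
noncomputable def numHonest (B : BlockTree) (s t : ℝ) : ℕ :=
  {k : ℕ | B.honest k ∧ s < B.T k ∧ B.T k ≤ t}.ncard

/-- The number of adversarial blocks mined during `(s, t]`. -/
noncomputable def numAdversarial (B : BlockTree) (s t : ℝ) : ℕ :=
  {k : ℕ | ¬ B.honest k ∧ s < B.T k ∧ B.T k ≤ t}.ncard

/-- Block `k` is a lagger: it is honest and it is the only honest block mined during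
`[T k - Δ, T k]`. -/
def IsLagger (B : BlockTree) (Δ : ℝ) (k : ℕ) : Prop :=
  B.honest k ∧ ∀ i, B.honest i → B.T k - Δ ≤ B.T i → B.T i ≤ B.T k → i = k

/-- Block `k` is a loner: it is a lagger and also the only honest block mined during
`[T k, T k + Δ]`. -/
def IsLoner (B : BlockTree) (Δ : ℝ) (k : ℕ) : Prop :=
  B.IsLagger Δ k ∧ ∀ i, B.honest i → B.T k ≤ B.T i → B.T i ≤ B.T k + Δ → i = k

/-- The number of laggers mined during `(s, t]`. -/
noncomputable def numLaggers (B : BlockTree) (Δ s t : ℝ) : ℕ :=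
  {k : ℕ | B.IsLagger Δ k ∧ s < B.T k ∧ B.T k ≤ t}.ncard

/-- The number of loners mined during `(s, t]`. -/
noncomputable def numLoners (B : BlockTree) (Δ s t : ℝ) : ℕ :=
  {k : ℕ | B.IsLoner Δ k ∧ s < B.T k ∧ B.T k ≤ t}.ncard

end BlockTree

/-- `g = e^{-αΔ}`. -/
noncomputable def discount (α Δ : ℝ) : ℝ := Real.exp (-(α * Δ))

/-- `η = δ² g² α`. -/
noncomputable def eta (α Δ δ : ℝ) : ℝ := δ ^ 2 * discount α Δ ^ 2 * α

/-- `μ = 9 e^{2η/27} / (1 - e^{-η/27})²`. -/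
noncomputable def mu (α Δ δ : ℝ) : ℝ :=
  9 * Real.exp (2 / 27 * eta α Δ δ) / (1 - Real.exp (-(1 / 27 * eta α Δ δ))) ^ 2

namespace BlockTree

/-- The realisation `B` belongs to the `δ`-good event with respect to `(s, t]`. -/
def Good (B : BlockTree) (α β Δ δ s t : ℝ) : Prop :=
  ((1 - δ) * (t - s) * α < B.numHonest s t ∧ B.numHonest s t < (1 + δ) * (t - s) * α) ∧
  (1 - δ) * (t - s) * discount α Δ * α < B.numLaggers Δ s t ∧
  (1 - δ) * (t - s) * discount α Δ ^ 2 * α < B.numLoners Δ s t ∧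
  B.numAdversarial s t < (t - s) * β + (t - s) * discount α Δ ^ 2 * α * δ

/-- The realisation `B` belongs to the `δ`-typical event on `(s, t]`. -/
def Typical (B : BlockTree) (α β Δ δ s t : ℝ) : Prop :=
  ∀ a b : ℝ, 0 ≤ a → a ≤ s → t ≤ b → B.Good α β Δ δ a b

/-- The vote on height `l` counted from the blockchain ending in block `b`: the first vote on that
height along the blockchain, where `vote k l` is the proposer block of height `l` pointed to by
block `k`, if any. -/
def chainVote (B : BlockTree) (vote : ℕ → ℕ → Option ℕ) : ℕ → ℕ → Option ℕ
  | 0, l => vote 0 l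
  | k + 1, l => (B.chainVote vote (B.parent (k + 1)) l).or (vote (k + 1) l)
termination_by k _ => k
decreasing_by exact B.parent_lt (k + 1) (Nat.succ_pos k)

end BlockTree

/-- One outcome of the Prism protocol with `m` voter blockchains and propagation delays bounded by
`Δ`. `tree 0` holds the proposer blocks and `tree j.succ`, `j : Fin m`, the `j`-th kind of
voter blocks. `vote j b l` is the proposer block of height `l` for which voter block `b` of kind `j`
votes, if any. `tieBreak` is the rule that picks one block out of a set of tied proposer blocks. The
adversarial blocks obey no rules except those that are common to all blocks. -/
structure Execution (m : ℕ) (Δ : ℝ) where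
  tree : Fin (m + 1) → BlockTree
  honestMining : ∀ j, (tree j).HonestMining Δ
  vote : Fin m → ℕ → ℕ → Option ℕ
  vote_height : ∀ j b l v, vote j b l = some v → (tree 0).height v = l
  /-- no voter block votes on a height at which nothing was published before it was mined -/
  vote_after : ∀ j b l v, vote j b l = some v →
    (tree 0).firstPublication l < ((tree j.succ).T b : EReal)
  /-- the block that a published voter block points to is published -/
  vote_published : ∀ j b l v, vote j b l = some v → (tree 0).P v ≤ (tree j.succ).P b
  /-- An honest voter block votes on every height at which a block was published at least `Δ`
  before, unless an ancestor has voted on that height. -/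
  honest_vote : ∀ j b l, 0 < b → (tree j.succ).honest b → 0 < l →
    (tree 0).firstPublication l ≤ (((tree j.succ).T b - Δ : ℝ) : EReal) →
    (tree j.succ).chainVote (vote j) ((tree j.succ).parent b) l = none →
    (vote j b l).isSome
  /-- An honest voter block chooses the first block of the height that its miner observes. The
  first one to be published is observed by everybody within `Δ`. -/
  honest_vote_first : ∀ j b l v, (tree j.succ).honest b → vote j b l = some v →
    (tree 0).P v ≤ (tree 0).firstPublication l + (Δ : EReal)
  tieBreak : Set ℕ → ℕ
  tieBreak_mem : ∀ S : Set ℕ, S.Nonempty → tieBreak S ∈ S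

namespace Execution

variable {m : ℕ} {Δ : ℝ}

/-- The number of votes that proposer block `v` receives on height `l` from the collection of voter
blockchains `c`. -/
def numVotes (S : Execution m Δ) (c : Fin m → ℕ) (l v : ℕ) : ℕ :=
  (Finset.univ.filter fun j : Fin m =>
    (S.tree j.succ).chainVote (S.vote j) (c j) l = some v).card

/-- The proposer blocks with the most votes from `c` among all proposer blocks of height `l`
published by time `t`. -/
def topBlocks (S : Execution m Δ) (t : ℝ) (c : Fin m → ℕ) (l : ℕ) : Set ℕ :=
  {v | ((S.tree 0).height v = l ∧ (S.tree 0).P v ≤ (t : EReal)) ∧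
    ∀ w, (S.tree 0).height w = l → (S.tree 0).P w ≤ (t : EReal) →
      S.numVotes c l w ≤ S.numVotes c l v}

/-- The collection `c` elects proposer block `v` at height `l` and time `t`. -/
def Elects (S : Execution m Δ) (t : ℝ) (c : Fin m → ℕ) (l v : ℕ) : Prop :=
  (S.topBlocks t c l).Nonempty ∧ S.tieBreak (S.topBlocks t c l) = v

/-- `L = (0, b₁, …, bₙ)` is a `t`-credible leader sequence: `n` is at least the height of every
proposer blockchain published by time `t - Δ`, and some collection of `t`-credible voter
blockchains, one of each kind, elects all of `b₁, …, bₙ`. -/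
def CredibleLeaderSequence (S : Execution m Δ) (t : ℝ) (L : List ℕ) : Prop :=
  ∃ bs : List ℕ, L = 0 :: bs ∧
    (∀ k, (S.tree 0).P k ≤ ((t - Δ : ℝ) : EReal) → (S.tree 0).height k ≤ bs.length) ∧
    ∃ c : Fin m → ℕ, (∀ j, (S.tree j.succ).Credible Δ t (c j)) ∧
      ∀ (i : ℕ) (hi : i < bs.length), S.Elects t c (i + 1) bs[i]

/-- The initial sequence of proposer blocks `p` is permanent after time `t`: it remains in all
`r`-credible leader sequences with `r ≥ t`. -/
def PermanentAfter (S : Execution m Δ) (t : ℝ) (p : List ℕ) : Prop :=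
  ∀ r, t ≤ r → ∀ L, S.CredibleLeaderSequence r L → p <+: L

/-- All `t`-credible leader sequences reach height `h` and share the same `h`-high prefix, and this
prefix is permanent after time `t`. -/
def CommonPermanentPrefix (S : Execution m Δ) (t : ℝ) (h : ℕ) : Prop :=
  (∀ L, S.CredibleLeaderSequence t L → h + 1 ≤ L.length) ∧
  (∀ L L', S.CredibleLeaderSequence t L → S.CredibleLeaderSequence t L' →
    L.take (h + 1) = L'.take (h + 1)) ∧
  ∀ L, S.CredibleLeaderSequence t L → S.PermanentAfter t (L.take (h + 1))

end Execution

/-- `N` is the counting process of a homogeneous Poisson point process of rate `α` on `(0, ∞)`. -/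
structure IsPoissonProcess {Ω : Type*} [MeasurableSpace Ω] (α : ℝ) (N : ℝ≥0 → Ω → ℕ)
    (Pr : Measure Ω) : Prop where
  zero : ∀ᵐ ω ∂Pr, N 0 ω = 0
  indep : HasIndepIncrements N Pr
  law : ∀ s t : ℝ≥0, s ≤ t →
    HasLaw (fun ω => N t ω - N s ω) (poissonMeasure (Real.toNNReal (α * (t - s)))) Pr

/-- The random outcome `S` of the Prism protocol: in each of the `m + 1` categories the honest
blocks are mined according to a Poisson process of rate `α`, and the number of adversarial blocks
mined during `(s, t]` is stochastically dominated by a Poisson variable of mean `β (t - s)`. -/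
structure IsPrismModel {Ω : Type*} [MeasurableSpace Ω] {m : ℕ} {Δ : ℝ} (α β : ℝ)
    (S : Ω → Execution m Δ) (Pr : Measure Ω) : Prop where
  measurable_T : ∀ j k, Measurable fun ω => ((S ω).tree j).T k
  measurableSet_honest : ∀ j k, MeasurableSet {ω | ((S ω).tree j).honest k}
  poisson : ∀ j, IsPoissonProcess α (fun t ω => ((S ω).tree j).numHonest 0 t) Pr
  dominated : ∀ j, ∀ s t : ℝ, 0 ≤ s → s < t → ∀ n : ℕ,
    Real.exp (-(β * (t - s))) * ∑ i ∈ Finset.range (n + 1), (β * (t - s)) ^ i / i.factorial ≤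
      Pr.real {ω | ((S ω).tree j).numAdversarial s t ≤ n}

/-- The intersection over the voter blockchains of the typical events on
`(t - k/(2α) + Δ, t - Δ]`. -/
def typicalEvent {Ω : Type*} {m : ℕ} {Δ : ℝ} (S : Ω → Execution m Δ) (α β δ : ℝ) (k : ℕ) (t : ℝ) :
    Set Ω :=
  {ω | ∀ j : Fin m,
    ((S ω).tree j.succ).Typical α β Δ δ (t - k / (2 * α) + Δ) (t - Δ)}

end Prism

/-! The argument splits into a pathwise half and a probabilistic half. Write `(s, u]` for the
typical window, so that `t = u + Δ`.

Pathwise, a loner is the only honest block of its height. If two credible voter chains had no common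
honest block mined after `s`, every loner after their last common honest block would face an
adversarial block of its own height. Typicality makes loners outnumber adversarial blocks, provided
the two chains are credible at nearly the same time (`common_honest_of_typical`). Moving forward in
time steps of at most one, all chains credible at time `t` or later contain the same blocks mined by
`s` (`anc_iff_of_typical`). Chain quality (`exists_honest_of_typical`) puts an honest block on such
a chain in any sufficiently long interval ending at `s`: laggers force the chain to grow faster than
adversarial blocks can supply it. With the interval starting at `R_h + Δ`, each voter tree has a
permanent honest block whose chain has voted on all heights `1, …, h` (`exists_permanent_honest`,
`exists_chainVote_of_honest`). Hence these votes never change, proposer blocks published later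
receive none of them, and the elected blocks are fixed (`topBlocks_eq`).

For the probability, honest and adversarial counts obey Chernoff bounds for Poisson variables.
Laggers and loners are handled by discretising time into cells of length `Δ / M`. A window of `M`
cells is hit if one of its cells has a single arrival and empty neighbourhoods; each hit supplies a
distinct lagger or loner, and windows whose indices differ by a multiple of three depend on disjoint
sets of cells. A Chernoff bound for each residue class modulo three gives `measureReal_count_le`. A
union bound over a unit grid of intervals containing `(s, u]` yields two geometric series, whence
the square in `mu` (`measure_not_typical_le`); another over the `m` voter trees finishes. -/

namespace Prism
namespace BlockTree

/-! ### Ancestry, heights and publication times in one block tree. -/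

/-- `B.Anc x y`: block `x` lies on the blockchain ending in block `y`. -/
inductive Anc (B : BlockTree) : ℕ → ℕ → Prop
  | refl (k : ℕ) : Anc B k k
  | step {x k : ℕ} : 0 < k → Anc B x (B.parent k) → Anc B x k

section Ancestors

variable {B : BlockTree} {x y z : ℕ}

lemma height_zero (B : BlockTree) : B.height 0 = 0 := by
  rw [height]

lemma height_of_pos (B : BlockTree) {k : ℕ} (hk : 0 < k) :
    B.height k = B.height (B.parent k) + 1 := by
  obtain ⟨n, rfl⟩ := Nat.exists_eq_succ_of_ne_zero hk.ne'
  rw [Nat.succ_eq_add_one, height]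

lemma T_nonneg (B : BlockTree) (k : ℕ) : 0 ≤ B.T k := by
  rcases Nat.eq_zero_or_pos k with rfl | hk
  · exact B.T_zero.ge
  · exact (B.T_pos k hk).le

lemma Anc.height_le (h : B.Anc x y) : B.height x ≤ B.height y := by
  induction h with
  | refl => rfl
  | step hk _ ih => rw [B.height_of_pos hk]; omega

lemma Anc.T_le (h : B.Anc x y) : B.T x ≤ B.T y := by
  induction h with
  | refl => rfl
  | step hk _ ih => exact ih.trans (B.T_parent_lt _ hk).le

lemma Anc.P_le (h : B.Anc x y) : B.P x ≤ B.P y := by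
  induction h with
  | refl => rfl
  | step hk _ ih => exact ih.trans (B.P_parent_le _ hk)

lemma Anc.T_lt (h : B.Anc x y) (hne : x ≠ y) : B.T x < B.T y := by
  cases h with
  | refl => exact absurd rfl hne
  | step hk h => exact h.T_le.trans_lt (B.T_parent_lt _ hk)

lemma Anc.height_lt (h : B.Anc x y) (hne : x ≠ y) : B.height x < B.height y := by
  cases h with
  | refl => exact absurd rfl hne
  | step hk h => rw [B.height_of_pos hk]; exact Nat.lt_succ_of_le h.height_le

lemma Anc.trans (hxy : B.Anc x y) (hyz : B.Anc y z) : B.Anc x z := by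
  induction hyz with
  | refl => exact hxy
  | step hk _ ih => exact .step hk ih

/-- The blocks of a blockchain are linearly ordered. -/
lemma Anc.of_height_le (hx : B.Anc x z) (hy : B.Anc y z) (h : B.height x ≤ B.height y) :
    B.Anc x y := by
  induction hx with
  | refl =>
    by_contra hne
    have : y ≠ x := by rintro rfl; exact hne (.refl _)
    have := hy.height_lt this
    omega
  | step hk hx ih =>
    cases hy with
    | refl => exact .step hk hx
    | step _ hy => exact ih hy

lemma Anc.eq_of_height_eq (hx : B.Anc x z) (hy : B.Anc y z) (h : B.height x = B.height y) :
    x = y := by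
  by_contra hne
  have := (hx.of_height_le hy h.le).height_lt hne
  omega

lemma Anc.of_T_lt (hx : B.Anc x z) (hy : B.Anc y z) (h : B.T x < B.T y) : B.Anc x y := by
  rcases le_total (B.height x) (B.height y) with h' | h'
  · exact hx.of_height_le hy h'
  · exact absurd (hy.of_height_le hx h').T_le (not_le.2 h)

lemma anc_zero (B : BlockTree) (y : ℕ) : B.Anc 0 y := by
  induction y using Nat.strong_induction_on with
  | _ y ih =>
    rcases Nat.eq_zero_or_pos y with rfl | hy
    · exact .refl 0
    · exact .step hy (ih _ (B.parent_lt y hy))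

lemma exists_anc_height (B : BlockTree) (y : ℕ) {l : ℕ} (hl : l ≤ B.height y) :
    ∃ x, B.Anc x y ∧ B.height x = l := by
  induction y using Nat.strong_induction_on with
  | _ y ih =>
    rcases hl.eq_or_lt with rfl | hl
    · exact ⟨y, .refl y, rfl⟩
    · have hy : 0 < y := by
        rcases Nat.eq_zero_or_pos y with rfl | hy
        · rw [B.height_zero] at hl; omega
        · exact hy
      rw [B.height_of_pos hy] at hl
      obtain ⟨x, hx, hxl⟩ := ih _ (B.parent_lt y hy) (Nat.lt_succ_iff.1 hl)
      exact ⟨x, .step hy hx, hxl⟩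

lemma finite_T_le (B : BlockTree) (t : ℝ) : {k | B.T k ≤ t}.Finite := by
  obtain ⟨n, hn⟩ := (B.T_tendsto.eventually_gt_atTop t).exists_forall_of_atTop
  refine (Set.finite_Iio n).subset fun k hk => ?_
  by_contra hkn
  exact absurd (hn k (not_lt.1 hkn)) (not_lt.2 hk)

lemma finite_mined (B : BlockTree) (p : ℕ → Prop) (s t : ℝ) :
    {k | p k ∧ s < B.T k ∧ B.T k ≤ t}.Finite :=
  (B.finite_T_le t).subset fun _ hk => hk.2.2

lemma T_le_of_P_le {t : ℝ} (h : B.P x ≤ (t : EReal)) : B.T x ≤ t :=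
  EReal.coe_le_coe_iff.1 ((B.T_le_P x).trans h)

lemma firstPublication_mono (B : BlockTree) {l h : ℕ} (hl : l ≤ h) :
    B.firstPublication l ≤ B.firstPublication h := by
  refine le_iInf₂ fun k hk => ?_
  obtain ⟨x, hx, hxl⟩ := B.exists_anc_height k (hk ▸ hl)
  exact (iInf₂_le x hxl).trans hx.P_le

lemma firstPublication_nonneg (B : BlockTree) (h : ℕ) : 0 ≤ B.firstPublication h :=
  le_iInf₂ fun k _ => (EReal.coe_nonneg.2 (B.T_nonneg k)).trans (B.T_le_P k)

/-- Only finitely many blocks are published by time `t`, so one of maximal height exists. It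
supplies the intermediate chains when credible chains at distant times are compared. -/
lemma exists_credible (B : BlockTree) (hB : B.honest 0 → B.P 0 = B.T 0) {Δ t : ℝ} (hΔ : 0 ≤ Δ)
    (ht : 0 ≤ t) : ∃ d, B.Credible Δ t d := by
  have hfin : {k | B.P k ≤ (t : EReal)}.Finite :=
    (B.finite_T_le t).subset fun k hk => T_le_of_P_le hk
  have h0 : B.P 0 ≤ (t : EReal) := by
    rw [hB B.honest_zero, B.T_zero]; exact_mod_cast ht
  obtain ⟨d, hd, hmax⟩ := Set.exists_max_image _ B.height hfin ⟨0, h0⟩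
  refine ⟨d, hd, fun k hk => hmax k (hk.trans ?_)⟩
  exact_mod_cast sub_le_self t hΔ

/-- Blocks of pairwise distinct heights are no more than the blocks of a set that contains a block
of each of these heights. -/
lemma ncard_le_of_height {A C : Set ℕ} (hA : Set.InjOn B.height A) (hC : C.Finite)
    (h : ∀ k ∈ A, ∃ x ∈ C, B.height x = B.height k) : A.ncard ≤ C.ncard := by
  choose! f hf hfh using h
  refine Set.ncard_le_ncard_of_injOn f hf (fun k hk l hl hkl => hA hk hl ?_) hC
  rw [← hfh k hk, ← hfh l hl, hkl]

end Ancestors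

/-! ### Height constraints from honest mining: growth by laggers, matching of loners. -/

section HonestMining

variable {B : BlockTree} {Δ : ℝ}

lemma HonestMining.height_lt (hB : B.HonestMining Δ) {i k : ℕ} (hk : B.honest k) (hi : B.honest i)
    (hk0 : 0 < k) (h : B.T i ≤ B.T k - Δ) : B.height i < B.height k := by
  have := (hB.2 k hk0 hk).2 i (by rw [hB.1 i hi]; exact_mod_cast h)
  rw [B.height_of_pos hk0]; omega

lemma pos_of_T_lt {i k : ℕ} (h : B.T i < B.T k) : 0 < k := by
  rcases Nat.eq_zero_or_pos k with rfl | hk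
  · rw [B.T_zero] at h; exact absurd (B.T_nonneg i) (not_le.2 h)
  · exact hk

lemma IsLagger.T_lt {i k : ℕ} (hk : B.IsLagger Δ k) (hi : B.honest i) (hik : i ≠ k)
    (h : B.T i ≤ B.T k) : B.T i < B.T k - Δ := by
  by_contra h'
  exact hik (hk.2 i hi (not_lt.1 h') h)

/-- A lagger is higher than all honest blocks that are mined before it. -/
lemma IsLagger.height_lt (hB : B.HonestMining Δ) (hΔ : 0 < Δ) {i k : ℕ} (hk : B.IsLagger Δ k)
    (hi : B.honest i) (hik : i ≠ k) (h : B.T i ≤ B.T k) : B.height i < B.height k := by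
  have h' := hk.T_lt hi hik h
  exact hB.height_lt hk.1 hi (pos_of_T_lt (h'.trans (sub_lt_self _ hΔ))) h'.le

lemma injOn_height_laggers (hB : B.HonestMining Δ) (hΔ : 0 < Δ) :
    Set.InjOn B.height {k | B.IsLagger Δ k} := by
  intro i hi k hk hik
  by_contra hne
  rcases le_total (B.T i) (B.T k) with h | h
  · exact (IsLagger.height_lt hB hΔ hk hi.1 hne h).ne hik
  · exact (IsLagger.height_lt hB hΔ hi hk.1 (Ne.symm hne) h).ne hik.symm

/-- A loner is the only honest block of its height. -/
lemma IsLoner.eq_of_height_eq (hB : B.HonestMining Δ) (hΔ : 0 < Δ) {i k : ℕ}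
    (hk : B.IsLoner Δ k) (hi : B.honest i) (h : B.height i = B.height k) : i = k := by
  by_contra hne
  rcases le_or_gt (B.T i) (B.T k) with h' | h'
  · exact (hk.1.height_lt hB hΔ hi hne h').ne h
  · have h2 : B.T k + Δ < B.T i := by
      by_contra h3
      exact hne (hk.2 i hi h'.le (not_lt.1 h3))
    exact (hB.height_lt hi hk.1.1 (pos_of_T_lt h') (by linarith)).ne h.symm

/-- Growth of the blockchains: every lagger raises the height of all credible blockchains. -/
lemma numLaggers_le_ncard (hB : B.HonestMining Δ) (hΔ : 0 < Δ) {r : ℝ} {d e : ℕ}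
    (hd : B.Credible Δ r d) (he : B.honest e) (hed : B.Anc e d) :
    B.numLaggers Δ (B.T e) (r - Δ) ≤ {x | B.Anc x d ∧ B.Anc e x ∧ x ≠ e}.ncard := by
  refine ncard_le_of_height (B := B)
    ((injOn_height_laggers hB hΔ).mono fun k hk => hk.1) ?_ ?_
  · exact (B.finite_T_le r).subset fun x hx => T_le_of_P_le (hx.1.P_le.trans hd.1)
  · rintro k ⟨hk, hek, hkr⟩
    have h1 : B.height e < B.height k :=
      hk.height_lt hB hΔ he (by rintro rfl; exact lt_irrefl _ hek) hek.le
    have h2 : B.height k ≤ B.height d := hd.2 k (by rw [hB.1 k hk.1]; exact_mod_cast hkr)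
    obtain ⟨x, hx, hxk⟩ := B.exists_anc_height d h2
    exact ⟨x, ⟨hx, hed.of_height_le hx (by omega), by rintro rfl; omega⟩, hxk⟩

/-- If the last common honest block of two credible blockchains is `e`, then every loner mined
after `e` is matched by an adversarial block of the same height. -/
lemma numLoners_le_numAdversarial (hB : B.HonestMining Δ) (hΔ : 0 < Δ) {r r' : ℝ} (hr : r ≤ r')
    {d d' e : ℕ} (hd : B.Credible Δ r d) (hd' : B.Credible Δ r' d') (he : B.honest e)
    (hed : B.Anc e d) (hed' : B.Anc e d')
    (hmax : ∀ x, B.honest x → B.Anc x d → B.Anc x d' → B.height x ≤ B.height e) :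
    B.numLoners Δ (B.T e) (r - Δ) ≤ B.numAdversarial (B.T e) r' := by
  refine ncard_le_of_height (B := B)
    ((injOn_height_laggers hB hΔ).mono fun k hk => hk.1.1) (B.finite_mined _ _ _) ?_
  rintro k ⟨hk, hek, hkr⟩
  have h1 : B.height e < B.height k :=
    hk.1.height_lt hB hΔ he (by rintro rfl; exact lt_irrefl _ hek) hek.le
  have h2 : B.height k ≤ B.height d := hd.2 k (by rw [hB.1 k hk.1.1]; exact_mod_cast hkr)
  have h3 : B.height k ≤ B.height d' :=
    hd'.2 k (by rw [hB.1 k hk.1.1]; exact_mod_cast hkr.trans (sub_le_sub_right hr Δ))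
  obtain ⟨x, hx, hxk⟩ := B.exists_anc_height d h2
  obtain ⟨x', hx', hxk'⟩ := B.exists_anc_height d' h3
  have hex : B.T e < B.T x :=
    (hed.of_height_le hx (by omega)).T_lt (by rintro rfl; omega)
  have hex' : B.T e < B.T x' :=
    (hed'.of_height_le hx' (by omega)).T_lt (by rintro rfl; omega)
  have hxr : B.T x ≤ r' := (T_le_of_P_le (hx.P_le.trans hd.1)).trans hr
  have hxr' : B.T x' ≤ r' := T_le_of_P_le (hx'.P_le.trans hd'.1)
  -- If both chains carried an honest block at the loner's height, both would be the loner itself: a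
  -- common honest block above `e`.
  by_cases hxh : B.honest x
  · by_cases hxh' : B.honest x'
    · have e1 := hk.eq_of_height_eq hB hΔ hxh hxk
      have e2 := hk.eq_of_height_eq hB hΔ hxh' hxk'
      subst e1
      subst e2
      have := hmax _ hxh hx hx'
      omega
    · exact ⟨x', ⟨hxh', hex', hxr'⟩, hxk'⟩
  · exact ⟨x, ⟨hxh, hex, hxr⟩, hxk⟩

lemma exists_last_common_honest (B : BlockTree) (d d' : ℕ) :
    ∃ e, B.honest e ∧ B.Anc e d ∧ B.Anc e d' ∧
      ∀ x, B.honest x → B.Anc x d → B.Anc x d' → B.height x ≤ B.height e := by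
  have hfin : {x | B.honest x ∧ B.Anc x d ∧ B.Anc x d'}.Finite :=
    (B.finite_T_le (B.T d)).subset fun x hx => hx.2.1.T_le
  obtain ⟨e, he, hmax⟩ := Set.exists_max_image _ B.height hfin
    ⟨0, B.honest_zero, B.anc_zero d, B.anc_zero d'⟩
  exact ⟨e, he.1, he.2.1, he.2.2, fun x h1 h2 h3 => hmax x ⟨h1, h2, h3⟩⟩

end HonestMining

/-! ### Common prefix and quality of credible chains on the typical event. -/

section CommonPrefix

variable {B : BlockTree} {α β Δ δ s u : ℝ}

/-- If the last common honest block `e` were mined by `s`, the loners in `(T e, r - Δ]` would be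
matched by adversarial blocks in `(T e, r']`. The second interval is longer by at most `1 + Δ`,
while the rates differ by a factor with margin `δ / 40`; a window with `δ (u - s) ≥ 40 (1 + Δ)`
makes this impossible. -/
lemma common_honest_of_typical (hB : B.HonestMining Δ) (hα : 0 < α) (hΔ : 0 < Δ) (hδ : 0 < δ)
    (hδ' : δ < 40 / 81) (hαβ : β < (1 - 81 / 40 * δ) * discount α Δ ^ 2 * α)
    (hT : B.Typical α β Δ δ s u) (hL : 40 * (1 + Δ) ≤ δ * (u - s)) {r r' : ℝ} (hur : u + Δ ≤ r)
    (hr : r ≤ r') (hr' : r' ≤ r + 1) {d d' : ℕ} (hd : B.Credible Δ r d)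
    (hd' : B.Credible Δ r' d') : ∃ e, B.Anc e d ∧ B.Anc e d' ∧ s < B.T e := by
  obtain ⟨e, he, hed, hed', hmax⟩ := B.exists_last_common_honest d d'
  refine ⟨e, hed, hed', ?_⟩
  by_contra hes
  have hes := not_lt.1 hes
  have hle := numLoners_le_numAdversarial hB hΔ hr hd hd' he hed hed' hmax
  have hY := (hT (B.T e) (r - Δ) (B.T_nonneg e) hes (by linarith)).2.2.1
  have hZ := (hT (B.T e) r' (B.T_nonneg e) hes (by linarith)).2.2.2
  have hle' : (B.numLoners Δ (B.T e) (r - Δ) : ℝ) ≤ B.numAdversarial (B.T e) r' := by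
    exact_mod_cast hle
  set γ := discount α Δ ^ 2 * α with hγ
  have hγ0 : 0 < γ := mul_pos (pow_pos (Real.exp_pos _) 2) hα
  have h1 : (1 - δ) * (r - Δ - B.T e) * γ <
      (r' - B.T e) * β + (r' - B.T e) * γ * δ := by
    have e1 : (1 - δ) * (r - Δ - B.T e) * discount α Δ ^ 2 * α
      = (1 - δ) * (r - Δ - B.T e) * γ := by rw [hγ]; ring
    have e2 : (r' - B.T e) * discount α Δ ^ 2 * α * δ = (r' - B.T e) * γ * δ := by
      rw [hγ]; ring
    rw [e1] at hY
    rw [e2] at hZ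
    linarith
  have h2 : (r' - B.T e) * β ≤ (r' - B.T e) * ((1 - 81 / 40 * δ) * γ) := by
    refine mul_le_mul_of_nonneg_left ?_ (by nlinarith)
    rw [hγ]; linarith
  have h3 : (1 - δ) * (r - Δ - B.T e) * γ < (r' - B.T e) * (1 - 41 / 40 * δ) * γ := by
    linarith
  have h4 := lt_of_mul_lt_mul_right h3 hγ0.le
  have h5 : (r' - B.T e) * (1 - 41 / 40 * δ) ≤
      (r - Δ - B.T e + (1 + Δ)) * (1 - 41 / 40 * δ) :=
    mul_le_mul_of_nonneg_right (by linarith) (by linarith)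
  have h6 : δ * (u - s) ≤ δ * (r - Δ - B.T e) :=
    mul_le_mul_of_nonneg_left (by linarith) hδ.le
  nlinarith

lemma anc_iff_of_common {e d d' x : ℕ} (hd : B.Anc e d) (hd' : B.Anc e d') (he : s < B.T e)
    (hx : B.T x ≤ s) : B.Anc x d ↔ B.Anc x d' :=
  ⟨fun h => (h.of_T_lt hd (hx.trans_lt he)).trans hd',
    fun h => (h.of_T_lt hd' (hx.trans_lt he)).trans hd⟩

/-- The blocks mined by time `s` are common to all credible blockchains. -/
lemma anc_iff_of_typical (hB : B.HonestMining Δ) (hα : 0 < α) (hΔ : 0 < Δ) (hδ : 0 < δ)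
    (hδ' : δ < 40 / 81) (hαβ : β < (1 - 81 / 40 * δ) * discount α Δ ^ 2 * α)
    (hT : B.Typical α β Δ δ s u) (hL : 40 * (1 + Δ) ≤ δ * (u - s)) (hu : 0 ≤ u + Δ) {r : ℝ}
    (hr : u + Δ ≤ r) {d d' x : ℕ} (hd : B.Credible Δ (u + Δ) d) (hd' : B.Credible Δ r d')
    (hx : B.T x ≤ s) : B.Anc x d ↔ B.Anc x d' := by
  -- Chains can be compared directly only when their times differ by at most one, since adversarial
  -- blocks are counted up to the later time and loners only up to the earlier one. Hence the
  -- induction on the number of unit steps.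
  obtain ⟨n, hn⟩ := exists_nat_ge (r - (u + Δ))
  induction n generalizing r d' with
  | zero =>
    have : r = u + Δ := le_antisymm (by simpa using hn) hr
    subst this
    obtain ⟨e, h1, h2, h3⟩ := common_honest_of_typical hB hα hΔ hδ hδ' hαβ hT hL le_rfl le_rfl
      (by linarith) hd hd'
    exact anc_iff_of_common h1 h2 h3 hx
  | succ n ih =>
    have hr0 : u + Δ ≤ max (u + Δ) (r - 1) := le_max_left _ _
    obtain ⟨d₀, hd₀⟩ := B.exists_credible (hB.1 0) hΔ.le (hu.trans hr0)
    obtain ⟨e, h1, h2, h3⟩ := common_honest_of_typical hB hα hΔ hδ hδ' hαβ hT hL hr0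
      (max_le hr (by linarith)) (by linarith [le_max_right (u + Δ) (r - 1)]) hd₀ hd'
    refine (ih hr0 hd₀ ?_).trans (anc_iff_of_common h1 h2 h3 hx)
    push_cast at hn
    rw [sub_le_iff_le_add]
    exact max_le (by linarith [n.cast_nonneg (α := ℝ)]) (by linarith)

lemma exists_last_honest (B : BlockTree) (d : ℕ) {v : ℝ} (hv : 0 < v) :
    ∃ e, B.honest e ∧ B.Anc e d ∧ B.T e < v ∧
      ∀ x, B.honest x → B.Anc x d → B.T x < v → B.height x ≤ B.height e := by
  have hfin : {x | B.honest x ∧ B.Anc x d ∧ B.T x < v}.Finite :=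
    (B.finite_T_le v).subset fun x hx => hx.2.2.le
  obtain ⟨e, he, hmax⟩ := Set.exists_max_image _ B.height hfin
    ⟨0, B.honest_zero, B.anc_zero d, B.T_zero.trans_lt hv⟩
  exact ⟨e, he.1, he.2.1, he.2.2, fun x h1 h2 h3 => hmax x ⟨h1, h2, h3⟩⟩

/-- Quality of the blockchains: an honest block mined in `[v, s]` is on a credible blockchain. -/
lemma exists_honest_of_typical (hB : B.HonestMining Δ) (hα : 0 < α) (hΔ : 0 < Δ) (hδ : 0 < δ)
    (hδ' : δ < 40 / 81) (hαβ : β < (1 - 81 / 40 * δ) * discount α Δ ^ 2 * α)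
    (hT : B.Typical α β Δ δ s u) (hsu : s ≤ u) {v : ℝ} (hv : 0 < v) (hvs : v ≤ s)
    (hvu : (1 + δ) * (u - s + 2 * Δ) ≤
      (1 - 41 / 40 * δ) * (1 - discount α Δ) * discount α Δ * (u + Δ - v)) {d : ℕ}
    (hd : B.Credible Δ (u + Δ) d) : ∃ b, B.honest b ∧ B.Anc b d ∧ v ≤ B.T b ∧ B.T b ≤ s := by
  by_contra! hcon
  obtain ⟨e, he, hed, hev, hmax⟩ := B.exists_last_honest d hv
  have hle := numLaggers_le_ncard hB hΔ hd he hed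
  -- Without an honest block in `[v, s]`, the chain beyond `e` can use only adversarial blocks and
  -- honest blocks mined after `s`; the lagger count bounds its length from below.
  have hsub : {x | B.Anc x d ∧ B.Anc e x ∧ x ≠ e} ⊆
      {k | ¬ B.honest k ∧ B.T e < B.T k ∧ B.T k ≤ u + Δ} ∪
        {k | B.honest k ∧ s < B.T k ∧ B.T k ≤ u + Δ} := by
    rintro x ⟨hx, hex, hne⟩
    have hxu : B.T x ≤ u + Δ := T_le_of_P_le (hx.P_le.trans hd.1)
    by_cases hxh : B.honest x
    · refine Or.inr ⟨hxh, hcon x hxh hx ?_, hxu⟩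
      by_contra hxv
      have h1 := hmax x hxh hx (not_le.1 hxv)
      have h2 := hex.height_lt hne.symm
      omega
    · exact Or.inl ⟨hxh, hex.T_lt hne.symm, hxu⟩
  have hcard := (Set.ncard_le_ncard hsub
    ((B.finite_mined _ _ _).union (B.finite_mined _ _ _))).trans (Set.ncard_union_le _ _)
  have hcard' : (B.numLaggers Δ (B.T e) u : ℝ) ≤
      B.numAdversarial (B.T e) (u + Δ) + B.numHonest s (u + Δ) := by
    rw [add_sub_cancel_right] at hle
    exact_mod_cast hle.trans hcard
  have hX := (hT (B.T e) u (B.T_nonneg e) (by linarith) le_rfl).2.1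
  have hZ := (hT (B.T e) (u + Δ) (B.T_nonneg e) (by linarith) (by linarith)).2.2.2
  have hN := (hT s (u + Δ) (by linarith) le_rfl (by linarith)).1.2
  set g := discount α Δ with hg
  have hg0 : 0 < g := Real.exp_pos _
  have hg1 : g < 1 := Real.exp_lt_one_iff.2 (by nlinarith)
  set y := u + Δ - B.T e with hy
  have hy0 : 0 < y := by linarith
  have h2 : y * β ≤ y * ((1 - 81 / 40 * δ) * g ^ 2 * α) :=
    mul_le_mul_of_nonneg_left hαβ.le hy0.le
  have h3 : (1 - δ) * (y - Δ) * g * α <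
      (y * ((1 - 41 / 40 * δ) * g ^ 2) + (1 + δ) * (u - s + Δ)) * α := by
    have e1 : u - B.T e = y - Δ := by rw [hy]; ring
    rw [e1] at hX
    have e2 : u + Δ - s = u - s + Δ := by ring
    rw [e2] at hN
    linarith
  have h4 := lt_of_mul_lt_mul_right h3 hα.le
  have hδ1 : 0 < 1 - 41 / 40 * δ := by linarith
  -- The difference between the lagger rate, about `g α`, and the adversarial rate, below `(1 -
  -- 41/40 δ) g² α`, produces the factor `(1 - g) g`.
  have h5 : (1 - 41 / 40 * δ) * (1 - g) * g * (u + Δ - v) ≤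
      (1 - 41 / 40 * δ) * (1 - g) * g * y :=
    mul_le_mul_of_nonneg_left (by linarith)
      (mul_nonneg (mul_nonneg hδ1.le (by linarith)) hg0.le)
  have h6 : (1 - 41 / 40 * δ) * (y * g) ≤ (1 - δ) * (y * g) :=
    mul_le_mul_of_nonneg_right (by linarith) (mul_pos hy0 hg0).le
  have h7 : (1 - δ) * (Δ * g) ≤ (1 + δ) * Δ :=
    mul_le_mul (by linarith) (mul_le_of_le_one_right hΔ.le hg1.le) (by positivity) (by linarith)
  linarith

end CommonPrefix

end BlockTree
-- Permanent honest voter blocks and the votes counted along a chain.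
lemma discount_pos (α Δ : ℝ) : 0 < discount α Δ := Real.exp_pos _

lemma discount_lt_one {α Δ : ℝ} (hα : 0 < α) (hΔ : 0 < Δ) : discount α Δ < 1 :=
  Real.exp_lt_one_iff.2 (neg_lt_zero.2 (mul_pos hα hΔ))

/-- The hypothesis on `k` bounds the length of the typical window from below. -/
lemma window_length {α Δ δ : ℝ} (hα : 1 / 2 < α) (hΔ : 0 < Δ) (hδ : 0 < δ) (hδ' : δ < 40 / 81)
    {k : ℕ} (hk : 160 * α * (1 + Δ) / δ ≤ k) :
    78 * (1 + Δ) ≤ δ * (k / (2 * α) - 2 * Δ) := by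
  have h1 : 160 * α * (1 + Δ) ≤ k * δ := (div_le_iff₀ hδ).1 hk
  have h2 : 80 * (1 + Δ) ≤ δ * (k / (2 * α)) := by
    rw [← mul_div_assoc, le_div_iff₀ (by linarith)]
    linarith
  nlinarith

namespace BlockTree

variable {B : BlockTree} {α β Δ δ : ℝ}

/-- Some honest block, mined no earlier than `v`, is on all blockchains that are credible at time
`t` or later. -/
lemma exists_permanent_honest (hB : B.HonestMining Δ) (hα : 1 / 2 < α) (hΔ : 0 < Δ) (hδ : 0 < δ)
    (hδ' : δ < 40 / 81) (hαβ : β < (1 - 81 / 40 * δ) * discount α Δ ^ 2 * α) {k : ℕ}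
    (hk : 160 * α * (1 + Δ) / δ ≤ k) {t : ℝ}
    (hT : B.Typical α β Δ δ (t - k / (2 * α) + Δ) (t - Δ)) {v : ℝ} (hv : 0 < v)
    (hvt : v + k / ((1 - 41 / 40 * δ) * (1 - discount α Δ) * discount α Δ * α) ≤ t) :
    ∃ b, B.honest b ∧ v ≤ B.T b ∧ B.T b ≤ t ∧ ∀ r, t ≤ r → ∀ d, B.Credible Δ r d → B.Anc b d := by
  have hα0 : 0 < α := by linarith
  have hw := window_length hα hΔ hδ hδ' hk
  have hg0 := discount_pos α Δ
  have hg1 := discount_lt_one hα0 hΔ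
  set g := discount α Δ with hg
  set c := (1 - 41 / 40 * δ) * (1 - g) * g with hc
  have hc0 : 0 < c := mul_pos (mul_pos (by linarith) (by linarith)) hg0
  have hc1 : c ≤ 1 := by
    have : (1 - g) * g ≤ 1 := by nlinarith
    rw [hc, mul_assoc]
    exact mul_le_one₀ (by linarith) (mul_nonneg (by linarith) hg0.le) this
  have hk0 : (0 : ℝ) ≤ k := k.cast_nonneg
  have hkα : c * (k / (c * α)) = 2 * (k / (2 * α)) := by field_simp
  have hkc : 2 * (k / (2 * α)) ≤ k / (c * α) := by
    rw [← hkα]; exact mul_le_of_le_one_left (by positivity) hc1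
  have hk2 : 0 ≤ k / (2 * α) := by positivity
  have hlen : 78 * (1 + Δ) ≤ k / (2 * α) - 2 * Δ := by nlinarith
  have hut : t - Δ + Δ = t := by ring
  obtain ⟨d₀, hd₀⟩ := B.exists_credible (hB.1 0) hΔ.le (t := t) (by linarith)
  obtain ⟨b, hb, hbd, hvb, hbs⟩ := exists_honest_of_typical hB hα0 hΔ hδ hδ' hαβ hT (by linarith) hv
    (by linarith) (by
      have h1 : c * (k / (c * α)) ≤ c * (t - Δ + Δ - v) :=
        mul_le_mul_of_nonneg_left (by linarith) hc0.le
      -- The waiting time times `c` is exactly `k / α`, twice `k / (2α)`; the spare factor covers `1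
      -- + δ`.
      have h2 : (1 + δ) * (k / (2 * α)) ≤ 2 * (k / (2 * α)) :=
        mul_le_mul_of_nonneg_right (by linarith) hk2
      have h3 : t - Δ - (t - k / (2 * α) + Δ) + 2 * Δ = k / (2 * α) := by ring
      rw [h3, ← hg, ← hc]
      linarith) (hut.symm ▸ hd₀)
  refine ⟨b, hb, hvb, by linarith, fun r hr d hd => ?_⟩
  refine (anc_iff_of_typical hB hα0 hΔ hδ hδ' hαβ hT ?_ (by linarith) (by linarith)
    (hut.symm ▸ hd₀) hd hbs).1 hbd
  have h3 : t - Δ - (t - k / (2 * α) + Δ) = k / (2 * α) - 2 * Δ := by ring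
  rw [h3]
  linarith

lemma chainVote_of_pos (B : BlockTree) (vote : ℕ → ℕ → Option ℕ) {k : ℕ} (hk : 0 < k) (l : ℕ) :
    B.chainVote vote k l = (B.chainVote vote (B.parent k) l).or (vote k l) := by
  obtain ⟨n, rfl⟩ := Nat.exists_eq_succ_of_ne_zero hk.ne'
  rw [Nat.succ_eq_add_one, chainVote]

/-- The earliest vote on a height takes precedence, so no descendant can override it. -/
lemma Anc.chainVote_eq {vote : ℕ → ℕ → Option ℕ} {x y l v : ℕ} (h : B.Anc x y)
    (hx : B.chainVote vote x l = some v) : B.chainVote vote y l = some v := by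
  induction h with
  | refl => exact hx
  | step hk _ ih => rw [chainVote_of_pos _ _ hk, ih, Option.some_or]

lemma exists_vote_of_chainVote {vote : ℕ → ℕ → Option ℕ} {y l v : ℕ}
    (h : B.chainVote vote y l = some v) : ∃ x, B.Anc x y ∧ vote x l = some v := by
  induction y using Nat.strong_induction_on with
  | _ y ih =>
    rcases Nat.eq_zero_or_pos y with rfl | hy
    · rw [chainVote] at h
      exact ⟨0, .refl 0, h⟩
    · rw [chainVote_of_pos _ _ hy, Option.or_eq_some_iff] at h
      rcases h with h | ⟨_, h⟩
      · obtain ⟨x, hx, hv⟩ := ih _ (B.parent_lt y hy) h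
        exact ⟨x, .step hy hx, hv⟩
      · exact ⟨y, .refl y, h⟩

end BlockTree

/-! ### Settled votes determine the leader sequence. -/

namespace Execution

variable {m : ℕ} {Δ : ℝ}

/-- The votes of the credible voter blockchains on height `l` are settled at time `t`. -/
def VotesSettled (S : Execution m Δ) (t : ℝ) (l : ℕ) : Prop :=
  ∀ j : Fin m, ∃ v, (S.tree 0).P v ≤ (t : EReal) ∧ ∀ r, t ≤ r → ∀ d,
    (S.tree j.succ).Credible Δ r d → (S.tree j.succ).chainVote (S.vote j) d l = some v

lemma chainVote_height (S : Execution m Δ) {j : Fin m} {d l v : ℕ}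
    (h : (S.tree j.succ).chainVote (S.vote j) d l = some v) : (S.tree 0).height v = l := by
  obtain ⟨x, -, hx⟩ := BlockTree.exists_vote_of_chainVote h
  exact S.vote_height _ _ _ _ hx

/-- An honest voter block settles the vote on heights published early enough. -/
lemma exists_chainVote_of_honest (S : Execution m Δ) {j : Fin m} {b l : ℕ} (hb : 0 < b)
    (hbh : (S.tree j.succ).honest b) (hl : 0 < l)
    (hR : (S.tree 0).firstPublication l ≤ (((S.tree j.succ).T b - Δ : ℝ) : EReal)) :
    ∃ v, (S.tree j.succ).chainVote (S.vote j) b l = some v ∧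
      (S.tree 0).P v ≤ ((S.tree j.succ).T b : EReal) := by
  have h1 : ∃ v, (S.tree j.succ).chainVote (S.vote j) b l = some v := by
    rw [← Option.isSome_iff_exists, BlockTree.chainVote_of_pos _ _ hb, Option.isSome_or]
    by_cases h : (S.tree j.succ).chainVote (S.vote j) ((S.tree j.succ).parent b) l = none
    · rw [S.honest_vote j b l hb hbh hl hR h, Bool.or_true]
    · rw [Option.isSome_iff_ne_none.2 h, Bool.true_or]
  obtain ⟨v, hv⟩ := h1
  obtain ⟨x, hx, hxv⟩ := BlockTree.exists_vote_of_chainVote hv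
  refine ⟨v, hv, (S.vote_published j x l v hxv).trans (hx.P_le.trans ?_)⟩
  rw [(S.honestMining j.succ).1 b hbh]

/-- Every block with a vote was published by time `t`, and since `m ≥ 1` some block has a vote. A
proposer block published after `t` therefore has no votes and cannot be on top. The tie-breaking
rule then receives the same set at both times. -/
lemma topBlocks_eq (S : Execution m Δ) (hm : 1 ≤ m) {t : ℝ} {l : ℕ} (hV : S.VotesSettled t l)
    {r : ℝ} (hr : t ≤ r) {c c' : Fin m → ℕ} (hc : ∀ j, (S.tree j.succ).Credible Δ t (c j))
    (hc' : ∀ j, (S.tree j.succ).Credible Δ r (c' j)) :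
    S.topBlocks r c' l = S.topBlocks t c l := by
  have hvotes : ∀ j, (S.tree j.succ).chainVote (S.vote j) (c' j) l =
      (S.tree j.succ).chainVote (S.vote j) (c j) l := fun j => by
    obtain ⟨v, -, hv⟩ := hV j
    rw [hv r hr _ (hc' j), hv t le_rfl _ (hc j)]
  have hnum : ∀ v, S.numVotes c' l v = S.numVotes c l v := fun v => by
    unfold numVotes; simp only [hvotes]
  have hpub : ∀ v, 0 < S.numVotes c l v → (S.tree 0).P v ≤ (t : EReal) := fun v hv => by
    obtain ⟨j, hj⟩ := Finset.card_pos.1 hv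
    obtain ⟨w, hw, hw'⟩ := hV j
    have h1 := (Finset.mem_filter.1 hj).2
    rw [hw' t le_rfl _ (hc j), Option.some_inj] at h1
    exact h1 ▸ hw
  have hpos : ∃ w, (S.tree 0).height w = l ∧ 0 < S.numVotes c l w := by
    obtain ⟨w, -, hw⟩ := hV ⟨0, hm⟩
    have hw := hw t le_rfl _ (hc _)
    exact ⟨w, S.chainVote_height hw,
      Finset.card_pos.2 ⟨⟨0, hm⟩, Finset.mem_filter.2 ⟨Finset.mem_univ _, hw⟩⟩⟩
  have htr : (t : EReal) ≤ (r : EReal) := by exact_mod_cast hr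
  obtain ⟨w₀, hw₀, hw₀'⟩ := hpos
  ext v
  simp only [topBlocks, Set.mem_ofPred_eq, hnum]
  constructor
  · rintro ⟨⟨h1, h2⟩, h3⟩
    have hv : 0 < S.numVotes c l v :=
      hw₀'.trans_le (h3 w₀ hw₀ ((hpub w₀ hw₀').trans htr))
    exact ⟨⟨h1, hpub v hv⟩, fun w hw hwt => h3 w hw (hwt.trans htr)⟩
  · rintro ⟨⟨h1, h2⟩, h3⟩
    refine ⟨⟨h1, h2.trans htr⟩, fun w hw _ => ?_⟩
    rcases Nat.eq_zero_or_pos (S.numVotes c l w) with h | h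
    · omega
    · exact h3 w hw (hpub w h)

lemma commonPermanentPrefix_of_votesSettled (S : Execution m Δ) (hm : 1 ≤ m) {t : ℝ} {h : ℕ}
    (hV : ∀ l, 1 ≤ l → l ≤ h → S.VotesSettled t l)
    (hpub : ∃ k, (S.tree 0).height k = h ∧ (S.tree 0).P k ≤ ((t - Δ : ℝ) : EReal)) :
    S.CommonPermanentPrefix t h := by
  obtain ⟨k, hk, hkP⟩ := hpub
  have hlen : ∀ r, t ≤ r → ∀ L, S.CredibleLeaderSequence r L → h + 1 ≤ L.length := by
    rintro r hr L ⟨bs, rfl, h1, -⟩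
    have := h1 k (hkP.trans (by exact_mod_cast sub_le_sub_right hr Δ))
    simp only [List.length_cons]
    omega
  have htake : ∀ r, t ≤ r → ∀ L L', S.CredibleLeaderSequence t L → S.CredibleLeaderSequence r L' →
      L.take (h + 1) = L'.take (h + 1) := by
    intro r hr L L' hL hL'
    have hl := hlen t le_rfl L hL
    have hl' := hlen r hr L' hL'
    obtain ⟨bs, rfl, -, c, hc, hE⟩ := hL
    obtain ⟨bs', rfl, -, c', hc', hE'⟩ := hL'
    simp only [List.length_cons] at hl hl'
    refine List.ext_getElem (by simp; omega) fun i hi hi' => ?_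
    simp only [List.length_take, List.length_cons] at hi hi'
    rw [List.getElem_take, List.getElem_take]
    cases i with
    | zero => rfl
    | succ i =>
      have e1 := (hE i (by omega)).2
      have e2 := (hE' i (by omega)).2
      rw [S.topBlocks_eq hm (hV (i + 1) (by omega) (by omega)) hr hc hc'] at e2
      simp only [List.getElem_cons_succ]
      rw [← e1, ← e2]
  refine ⟨hlen t le_rfl, htake t le_rfl, fun L hL r hr L' hL' => ?_⟩
  rw [htake r hr L L' hL hL']
  exact List.take_prefix _ _

end Execution

/-- The deterministic part of the theorem: on the typical event, leader sequences have a common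
permanent prefix. -/
theorem commonPermanentPrefix_of_typical {m : ℕ} (hm : 1 ≤ m) {α β Δ δ : ℝ} (hα : 1 / 2 < α)
    (hΔ : 0 < Δ) (hδ : 0 < δ) (hδ' : δ < 40 / 81)
    (hαβ : β < (1 - 81 / 40 * δ) * discount α Δ ^ 2 * α) (S : Execution m Δ) {k : ℕ}
    (hk : 160 * α * (1 + Δ) / δ ≤ k) {h : ℕ} {t : ℝ}
    (hT : ∀ j : Fin m, (S.tree j.succ).Typical α β Δ δ (t - k / (2 * α) + Δ) (t - Δ))
    (hR : (S.tree 0).firstPublication h +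
      ((k / ((1 - 41 / 40 * δ) * (1 - discount α Δ) * discount α Δ * α) + Δ : ℝ) : EReal) ≤
        (t : EReal)) :
    S.CommonPermanentPrefix t h := by
  have hg0 := discount_pos α Δ
  have hg1 := discount_lt_one (by linarith : 0 < α) hΔ
  set K := k / ((1 - 41 / 40 * δ) * (1 - discount α Δ) * discount α Δ * α) with hK
  have hk0 : (0 : ℝ) < k := lt_of_lt_of_le (by positivity) hk
  have hK0 : 0 < K := div_pos hk0
    (mul_pos (mul_pos (mul_pos (by linarith) (by linarith)) hg0) (by linarith))
  have hR0 := (S.tree 0).firstPublication_nonneg h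
  obtain ⟨R, hRR⟩ : ∃ R : ℝ, (S.tree 0).firstPublication h = (R : EReal) := by
    -- The waiting condition excludes an infinite `R_h`, and nonnegativity excludes `⊥`.
    induction hF : (S.tree 0).firstPublication h with
    | bot => rw [hF] at hR0; exact absurd hR0 (by simp)
    | top => rw [hF, EReal.top_add_coe] at hR; exact absurd hR (by simp)
    | coe R => exact ⟨R, rfl⟩
  rw [hRR] at hR hR0
  have hR0 : 0 ≤ R := by exact_mod_cast hR0
  have hR : R + (K + Δ) ≤ t := by exact_mod_cast hR
  refine S.commonPermanentPrefix_of_votesSettled hm (fun l hl hlh j => ?_) ?_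
  · obtain ⟨b, hb, hvb, hbt, hall⟩ := BlockTree.exists_permanent_honest (S.honestMining j.succ)
      -- An honest block mined at `R_h + Δ` or later must have a vote on its chain for each height
      -- from `1` to `h`.
      hα hΔ hδ hδ' hαβ hk (hT j) (v := R + Δ) (by linarith) (by rw [← hK]; linarith)
    have hb0 : 0 < b := BlockTree.pos_of_T_lt (B := S.tree j.succ) (i := 0)
      (by rw [(S.tree j.succ).T_zero]; linarith)
    obtain ⟨v, hv, hvP⟩ := S.exists_chainVote_of_honest hb0 hb hl
      (((S.tree 0).firstPublication_mono hlh).trans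
        (by rw [hRR]; exact_mod_cast le_sub_iff_add_le.2 hvb))
    exact ⟨v, hvP.trans (by exact_mod_cast hbt), fun r hr d hd => (hall r hr d hd).chainVote_eq hv⟩
  -- Strictness, from `K > 0`, turns the infimum `R_h` into an actual block of height `h` published
  -- by `t - Δ`.
  · have hlt : (S.tree 0).firstPublication h < ((t - Δ : ℝ) : EReal) := by
      rw [hRR]; exact_mod_cast (by linarith : R < t - Δ)
    obtain ⟨x, hx⟩ := iInf_lt_iff.1 hlt
    obtain ⟨hxh, hx⟩ := iInf_lt_iff.1 hx
    exact ⟨x, hxh, hx.le⟩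

/-! ### Exponential moments and Chernoff bounds for Poisson variables. -/

section Poisson

/-- `(1 - x + x²/2)(1 + x + x²/2) = 1 + x⁴/4 ≥ 1`, and the second factor is at most `e^x`. -/
lemma exp_neg_le_quadratic {x : ℝ} (hx : 0 ≤ x) : Real.exp (-x) ≤ 1 - x + x ^ 2 / 2 := by
  have h1 := Real.quadratic_le_exp_of_nonneg hx
  have h2 : Real.exp (-x) * Real.exp x = 1 := by rw [← Real.exp_add]; simp
  have h3 : 0 ≤ 1 - x + x ^ 2 / 2 := by nlinarith [sq_nonneg (x - 1)]
  have h4 := mul_le_mul_of_nonneg_left h1 h3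
  have h5 : 1 ≤ (1 - x + x ^ 2 / 2) * Real.exp x := by nlinarith [sq_nonneg (x ^ 2)]
  exact le_of_mul_le_mul_right (h2.trans_le h5) (Real.exp_pos x)

lemma exp_le_quadratic {x : ℝ} (hx : 0 ≤ x) (hx1 : x ≤ 1) : Real.exp x ≤ 1 + x + x ^ 2 := by
  have h := abs_le.1 (Real.abs_exp_sub_one_sub_id_le (abs_le.2 ⟨by linarith, hx1⟩))
  linarith [h.2]

lemma hasSum_exp_poissonMeasure (r : ℝ≥0) (θ : ℝ) :
    HasSum (fun n : ℕ => Real.exp (-r) * r ^ n / n.factorial * Real.exp (θ * n))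
      (Real.exp (r * (Real.exp θ - 1))) := by
  have h := (NormedSpace.expSeries_div_hasSum_exp ((r : ℝ) * Real.exp θ)).mul_left
    (Real.exp (-r))
  rw [← Real.exp_eq_exp_ℝ, ← Real.exp_add] at h
  have e1 : (fun n : ℕ => Real.exp (-r) * r ^ n / n.factorial * Real.exp (θ * n)) =
      fun n : ℕ => Real.exp (-r) * ((r * Real.exp θ) ^ n / n.factorial) := by
    funext n
    rw [mul_pow, ← Real.exp_nat_mul, mul_comm θ]
    ring
  have e2 : (r : ℝ) * (Real.exp θ - 1) = -r + r * Real.exp θ := by ring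
  rw [e1, e2]
  exact h

lemma integrable_exp_poissonMeasure (r : ℝ≥0) (θ : ℝ) :
    Integrable (fun n : ℕ => Real.exp (θ * n)) (poissonMeasure r) := by
  rw [integrable_poissonMeasure_iff]
  simpa using (hasSum_exp_poissonMeasure r θ).summable

lemma mgf_poissonMeasure (r : ℝ≥0) (θ : ℝ) :
    mgf (fun n : ℕ => (n : ℝ)) (poissonMeasure r) θ = Real.exp (r * (Real.exp θ - 1)) := by
  rw [mgf, integral_poissonMeasure]
  exact (hasSum_exp_poissonMeasure r θ).tsum_eq

lemma poissonMeasure_ge_le (r : ℝ≥0) (y : ℝ) {θ : ℝ} (hθ : 0 ≤ θ) (hθ1 : θ ≤ 1) :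
    (poissonMeasure r).real {n | y ≤ n} ≤ Real.exp (-θ * y + r * (θ + θ ^ 2)) := by
  refine (measure_ge_le_exp_mul_mgf y hθ (integrable_exp_poissonMeasure r θ)).trans ?_
  rw [mgf_poissonMeasure, ← Real.exp_add, Real.exp_le_exp]
  have := mul_le_mul_of_nonneg_left (exp_le_quadratic hθ hθ1) r.coe_nonneg
  linarith

lemma poissonMeasure_le_le (r : ℝ≥0) (y : ℝ) {θ : ℝ} (hθ : 0 ≤ θ) :
    (poissonMeasure r).real {n | (n : ℝ) ≤ y} ≤ Real.exp (θ * y - r * (θ - θ ^ 2 / 2)) := by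
  refine (measure_le_le_exp_mul_mgf y (neg_nonpos.2 hθ)
    (integrable_exp_poissonMeasure r (-θ))).trans ?_
  rw [mgf_poissonMeasure, ← Real.exp_add, Real.exp_le_exp]
  have := mul_le_mul_of_nonneg_left (exp_neg_le_quadratic hθ) r.coe_nonneg
  linarith

end Poisson

/-! ### Chernoff bound for indicators of disjoint blocks of an independent sequence. -/

section Blocks

variable {Ω : Type*} [MeasurableSpace Ω] {Pr : Measure Ω} {ξ : ℕ → Ω → ℕ}

/-- A function of finitely many coordinates of a sequence is a function on a discrete space. -/
lemma exists_eq_restrict {E : Type*} {F : (ℕ → ℕ) → E} {s : Finset ℕ}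
    (hF : DependsOn F (s : Set ℕ)) : ∃ f : (s → ℕ) → E, ∀ x : ℕ → ℕ, F x = f fun i => x i := by
  classical
  refine ⟨fun y => F fun i => if h : i ∈ s then y ⟨i, h⟩ else 0, fun x => hF fun i hi => ?_⟩
  simp [Finset.mem_coe.1 hi]

lemma aemeasurable_of_dependsOn (hξ : ∀ i, AEMeasurable (ξ i) Pr) {F : (ℕ → ℕ) → ℝ}
    {s : Finset ℕ} (hF : DependsOn F (s : Set ℕ)) : AEMeasurable (fun ω => F fun i => ξ i ω) Pr := by
  obtain ⟨f, hf⟩ := exists_eq_restrict hF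
  simp only [hf]
  exact (measurable_of_countable f).comp_aemeasurable (aemeasurable_pi_lambda _ fun i => hξ i)

lemma indepFun_of_dependsOn (hind : iIndepFun ξ Pr) (hξ : ∀ i, AEMeasurable (ξ i) Pr)
    {F G : (ℕ → ℕ) → ℝ} {s u : Finset ℕ} (hsu : Disjoint s u) (hF : DependsOn F (s : Set ℕ))
    (hG : DependsOn G (u : Set ℕ)) :
    IndepFun (fun ω => F fun i => ξ i ω) (fun ω => G fun i => ξ i ω) Pr := by
  obtain ⟨f, hf⟩ := exists_eq_restrict hF
  obtain ⟨g, hg⟩ := exists_eq_restrict hG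
  simp only [hf, hg]
  exact (hind.indepFun_finset₀ s u hsu hξ).comp (measurable_of_countable f)
    (measurable_of_countable g)

/-- The Laplace transform of a sum of Bernoulli variables that depend on disjoint blocks of an
independent sequence. -/
lemma integral_exp_sum_le [IsProbabilityMeasure Pr] (hind : iIndepFun ξ Pr)
    (hξ : ∀ i, AEMeasurable (ξ i) Pr) {F : ℕ → (ℕ → ℕ) → ℝ} {W o : ℕ}
    (hF : ∀ q, DependsOn (F q) (Finset.Ico (o + W * q) (o + W * (q + 1)) : Set ℕ))
    (hF01 : ∀ q x, F q x = 0 ∨ F q x = 1) {p : ℝ}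
    (hp : ∀ q, p ≤ ∫ ω, F q (fun i => ξ i ω) ∂Pr) {θ : ℝ} (hθ : 0 ≤ θ) (n : ℕ) :
    ∫ ω, Real.exp (-θ * ∑ q ∈ Finset.range n, F q fun i => ξ i ω) ∂Pr ≤
      Real.exp (-(n * p * (1 - Real.exp (-θ)))) := by
  have hm : ∀ q, AEMeasurable (fun ω => F q fun i => ξ i ω) Pr := fun q =>
    aemeasurable_of_dependsOn (s := Finset.Ico (o + W * q) (o + W * (q + 1))) hξ
      (by simpa using hF q)
  have hint : ∀ q, Integrable (fun ω => F q fun i => ξ i ω) Pr := fun q =>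
    Integrable.of_bound (hm q).aestronglyMeasurable 1
      (ae_of_all _ fun ω => by rcases hF01 q fun i => ξ i ω with h | h <;> simp [h])
  induction n with
  | zero => simp
  | succ n ih =>
    have hdep : DependsOn (fun x => Real.exp (-θ * ∑ q ∈ Finset.range n, F q x))
        (Finset.range (o + W * n) : Set ℕ) := by
      intro x y hxy
      have : ∀ q ∈ Finset.range n, F q x = F q y := fun q hq => hF q fun i hi => by
        refine hxy i ?_
        have hq' := Finset.mem_range.1 hq
        simp only [Finset.coe_Ico, Set.mem_Ico] at hi
        have : W * (q + 1) ≤ W * n := Nat.mul_le_mul_left W hq'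
        simp only [Finset.coe_range, Set.mem_Iio]
        omega
      simp only [Finset.sum_congr rfl this]
    have hdep' : DependsOn (fun x => Real.exp (-θ * F n x))
        (Finset.Ico (o + W * n) (o + W * (n + 1)) : Set ℕ) := fun x y hxy => by
      simp only [hF n hxy]
    have hdisj : Disjoint (Finset.range (o + W * n))
        (Finset.Ico (o + W * n) (o + W * (n + 1))) := by
      rw [Finset.disjoint_left]
      intro i hi hi'
      have := Finset.mem_range.1 hi
      have := (Finset.mem_Ico.1 hi').1
      omega
    have hdep'' : DependsOn (fun x => Real.exp (-θ * F n x))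
        ((Finset.Ico (o + W * n) (o + W * (n + 1)) : Finset ℕ) : Set ℕ) := by simpa using hdep'
    have hmul := (indepFun_of_dependsOn hind hξ hdisj hdep hdep'').integral_fun_mul_eq_mul_integral
      (aemeasurable_of_dependsOn hξ hdep).aestronglyMeasurable
      (aemeasurable_of_dependsOn hξ hdep'').aestronglyMeasurable
    -- On the values `0` and `1` the exponential is affine, so its mean is controlled by the mean of
    -- `F n`.
    have hlin : ∀ ω, Real.exp (-θ * F n fun i => ξ i ω) =
        1 - (1 - Real.exp (-θ)) * F n fun i => ξ i ω := fun ω => by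
      rcases hF01 n fun i => ξ i ω with h | h <;> simp [h]
    have hone : ∫ ω, Real.exp (-θ * F n fun i => ξ i ω) ∂Pr ≤
        Real.exp (-(p * (1 - Real.exp (-θ)))) := by
      simp only [hlin]
      rw [integral_sub (integrable_const _) ((hint n).const_mul _), integral_const_mul]
      have h1 : 0 ≤ 1 - Real.exp (-θ) := by
        rw [sub_nonneg, Real.exp_le_one_iff]; linarith
      have h2 := mul_le_mul_of_nonneg_left (hp n) h1
      have h3 := Real.add_one_le_exp (-(p * (1 - Real.exp (-θ))))
      simp only [integral_const, probReal_univ, smul_eq_mul, mul_one]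
      linarith
    simp only [Finset.sum_range_succ, mul_add, Real.exp_add]
    rw [hmul]
    calc _ ≤ Real.exp (-(n * p * (1 - Real.exp (-θ)))) * Real.exp (-(p * (1 - Real.exp (-θ)))) :=
          mul_le_mul ih hone (integral_nonneg fun _ => (Real.exp_pos _).le) (Real.exp_pos _).le
      _ = _ := by rw [← Real.exp_add]; push_cast; ring_nf

lemma sum_le_le_of_blocks [IsProbabilityMeasure Pr] (hind : iIndepFun ξ Pr)
    (hξ : ∀ i, AEMeasurable (ξ i) Pr) {F : ℕ → (ℕ → ℕ) → ℝ} {W o : ℕ}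
    (hF : ∀ q, DependsOn (F q) (Finset.Ico (o + W * q) (o + W * (q + 1)) : Set ℕ))
    (hF01 : ∀ q x, F q x = 0 ∨ F q x = 1) {p : ℝ} (hp0 : 0 ≤ p)
    (hp : ∀ q, p ≤ ∫ ω, F q (fun i => ξ i ω) ∂Pr) {θ : ℝ} (hθ : 0 ≤ θ) (n : ℕ) :
    Pr.real {ω | ∑ q ∈ Finset.range n, F q (fun i => ξ i ω) ≤ (1 - θ) * (n * p)} ≤
      Real.exp (-(n * p * (θ ^ 2 / 2))) := by
  have hm : ∀ q, AEMeasurable (fun ω => F q fun i => ξ i ω) Pr := fun q =>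
    aemeasurable_of_dependsOn (s := Finset.Ico (o + W * q) (o + W * (q + 1))) hξ
      (by simpa using hF q)
  have hnn : ∀ ω, 0 ≤ ∑ q ∈ Finset.range n, F q (fun i => ξ i ω) := fun ω =>
    Finset.sum_nonneg fun q _ => by rcases hF01 q fun i => ξ i ω with h | h <;> simp [h]
  have hint : Integrable (fun ω => Real.exp (-θ * ∑ q ∈ Finset.range n, F q fun i => ξ i ω)) Pr := by
    refine Integrable.of_bound (C := 1) (Real.measurable_exp.comp_aemeasurable
      ((Finset.aemeasurable_fun_sum _ fun q _ => hm q).const_mul _)).aestronglyMeasurable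
      (ae_of_all _ fun ω => ?_)
    rw [Real.norm_eq_abs, abs_of_pos (Real.exp_pos _), Real.exp_le_one_iff]
    nlinarith [hnn ω]
  refine (measure_le_le_exp_mul_mgf _ (neg_nonpos.2 hθ) hint).trans ?_
  refine (mul_le_mul_of_nonneg_left
    (integral_exp_sum_le hind hξ hF hF01 hp hθ n) (Real.exp_pos _).le).trans ?_
  rw [← Real.exp_add, Real.exp_le_exp]
  have hnp : 0 ≤ n * p := mul_nonneg n.cast_nonneg hp0
  have := mul_le_mul_of_nonneg_left (exp_neg_le_quadratic hθ) hnp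
  nlinarith

end Blocks

/-! ### Isolated arrivals in a discretised Poisson process. -/

section Isolated

/-- Cell `c` contains one arrival, and the `M` cells before it and the `w` cells after it contain
none. -/
def Isolated (M w : ℕ) (x : ℕ → ℕ) (c : ℕ) : Prop :=
  x c = 1 ∧ ∀ i, c ≤ i + M → i ≤ c + w → i ≠ c → x i = 0

/-- Some cell of the window `j` is isolated. -/
def WindowHit (M w : ℕ) (j : ℕ) (x : ℕ → ℕ) : Prop :=
  ∃ c, M * (j + 1) ≤ c ∧ c < M * (j + 2) ∧ Isolated M w x c

open Classical in
/-- The indicator of `WindowHit`. -/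
noncomputable def hit (M w : ℕ) (j : ℕ) (x : ℕ → ℕ) : ℝ := if WindowHit M w j x then 1 else 0

lemma hit_eq_zero_or_one (M w j : ℕ) (x : ℕ → ℕ) : hit M w j x = 0 ∨ hit M w j x = 1 := by
  unfold hit; split_ifs <;> simp

lemma windowHit_congr {M w j : ℕ} (hw : w ≤ M) {x y : ℕ → ℕ}
    (h : ∀ i, M * j ≤ i → i < M * (j + 3) → x i = y i) (hx : WindowHit M w j x) :
    WindowHit M w j y := by
  obtain ⟨c, h1, h2, h3, h4⟩ := hx
  have e1 : M * (j + 1) = M * j + M := by ring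
  have e2 : M * (j + 2) = M * j + 2 * M := by ring
  have e3 : M * (j + 3) = M * j + 3 * M := by ring
  exact ⟨c, h1, h2, by rw [← h c (by omega) (by omega)]; exact h3,
    fun i hi hi' hne => by rw [← h i (by omega) (by omega)]; exact h4 i hi hi' hne⟩

/-- Isolation looks back `M` cells and ahead at most `M`, so window `j` involves three consecutive
runs of `M` cells; windows `j` and `j + 3` share none. -/
lemma dependsOn_hit {M w j : ℕ} (hw : w ≤ M) :
    DependsOn (hit M w j) (Finset.Ico (M * j) (M * (j + 3)) : Set ℕ) := by
  intro x y hxy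
  have h : ∀ i, M * j ≤ i → i < M * (j + 3) → x i = y i := fun i h1 h2 => hxy i (by
    simpa using ⟨h1, h2⟩)
  have : WindowHit M w j x ↔ WindowHit M w j y :=
    ⟨windowHit_congr hw h, windowHit_congr hw fun i h1 h2 => (h i h1 h2).symm⟩
  by_cases hx : WindowHit M w j x
  · simp [hit, hx, this.1 hx]
  · simp [hit, hx, this.not.1 hx]

variable {Ω : Type*} [MeasurableSpace Ω] {Pr : Measure Ω} {ξ : ℕ → Ω → ℕ} {ρ : ℝ≥0}

lemma nullMeasurableSet_isolated (hlaw : ∀ i, HasLaw (ξ i) (poissonMeasure ρ) Pr) (M w c : ℕ) :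
    NullMeasurableSet {ω | Isolated M w (fun i => ξ i ω) c} Pr := by
  have h : ∀ i n, NullMeasurableSet {ω | ξ i ω = n} Pr := fun i n =>
    (hlaw i).aemeasurable.nullMeasurable (measurableSet_singleton n)
  have : {ω | Isolated M w (fun i => ξ i ω) c} = {ω | ξ c ω = 1} ∩
      ⋂ i, {ω | c ≤ i + M → i ≤ c + w → i ≠ c → ξ i ω = 0} := by
    ext ω; simp [Isolated]
  rw [this]
  refine (h c 1).inter (NullMeasurableSet.iInter fun i => ?_)
  by_cases hi : c ≤ i + M ∧ i ≤ c + w ∧ i ≠ c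
  · simpa [hi] using h i 0
  · have : {ω | c ≤ i + M → i ≤ c + w → i ≠ c → ξ i ω = 0} = Set.univ := by
      ext ω; simp only [Set.mem_ofPred_eq, Set.mem_univ, iff_true]; tauto
    rw [this]; exact nullMeasurableSet_univ

lemma measureReal_isolated (hind : iIndepFun ξ Pr)
    (hlaw : ∀ i, HasLaw (ξ i) (poissonMeasure ρ) Pr) {M w c : ℕ} (hc : M ≤ c) :
    Pr.real {ω | Isolated M w (fun i => ξ i ω) c} =
      ρ * Real.exp (-ρ) * Real.exp (-(ρ * (M + w))) := by
  have hset : {ω | Isolated M w (fun i => ξ i ω) c} =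
      ⋂ i ∈ Finset.Icc (c - M) (c + w), ξ i ⁻¹' {if i = c then 1 else 0} := by
    ext ω
    simp only [Isolated, Set.mem_ofPred_eq, Set.mem_iInter, Finset.mem_Icc, Set.mem_preimage,
      Set.mem_singleton_iff]
    constructor
    · rintro ⟨h1, h2⟩ i hi
      split_ifs with hic
      · rw [hic, h1]
      · exact h2 i (by omega) hi.2 hic
    · intro h
      refine ⟨by simpa using h c ⟨by omega, by omega⟩, fun i h1 h2 hne => ?_⟩
      simpa [hne] using h i ⟨by omega, h2⟩
  have hprob : ∀ i n, Pr.real (ξ i ⁻¹' {n}) = Real.exp (-ρ) * ρ ^ n / n.factorial := fun i n => by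
    rw [← poissonMeasure_real_singleton, ← (hlaw i).map_eq, measureReal_def, measureReal_def,
      Measure.map_apply_of_aemeasurable (hlaw i).aemeasurable (measurableSet_singleton n)]
  rw [hset, measureReal_def, hind.measure_inter_preimage_eq_mul _ fun i _ => measurableSet_singleton _,
    ENNReal.toReal_prod]
  change ∏ i ∈ _, Pr.real _ = _
  simp only [hprob]
  rw [← Finset.mul_prod_erase _ _ (Finset.mem_Icc.2 ⟨Nat.sub_le c M, Nat.le_add_right c w⟩),
    Finset.prod_congr rfl (g := fun _ => Real.exp (-ρ))
      (fun i hi => by simp [Finset.ne_of_mem_erase hi]), Finset.prod_const,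
    Finset.card_erase_of_mem (Finset.mem_Icc.2 ⟨Nat.sub_le c M, Nat.le_add_right c w⟩), Nat.card_Icc,
    ← Real.exp_nat_mul]
  have : c + w + 1 - (c - M) - 1 = M + w := by omega
  rw [this]
  simp only [if_true, pow_one, Nat.factorial_one, Nat.cast_one, div_one]
  push_cast
  ring_nf

/-- Two cells of one window cannot both be isolated: the later one requires the `M` cells before it
to be empty. The hit probability is thus an exact sum of `M` equal terms, with no
inclusion-exclusion loss. -/
lemma le_integral_hit [IsProbabilityMeasure Pr] (hind : iIndepFun ξ Pr)
    (hlaw : ∀ i, HasLaw (ξ i) (poissonMeasure ρ) Pr) {M w : ℕ} (j : ℕ) :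
    M * (ρ * Real.exp (-ρ) * Real.exp (-(ρ * (M + w)))) ≤
      ∫ ω, hit M w j (fun i => ξ i ω) ∂Pr := by
  have hset : {ω | WindowHit M w j fun i => ξ i ω} =
      ⋃ c ∈ Finset.Ico (M * (j + 1)) (M * (j + 2)), {ω | Isolated M w (fun i => ξ i ω) c} := by
    ext ω
    simp [WindowHit, and_assoc]
  have hdisj : (Finset.Ico (M * (j + 1)) (M * (j + 2)) : Set ℕ).Pairwise
      (Function.onFun (AEDisjoint Pr) fun c => {ω | Isolated M w (fun i => ξ i ω) c}) := by
    intro c hc c' hc' hne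
    refine Disjoint.aedisjoint (Set.disjoint_left.2 fun ω h h' => ?_)
    simp only [Finset.coe_Ico, Set.mem_Ico] at hc hc'
    have e2 : M * (j + 2) = M * (j + 1) + M := by ring
    obtain ⟨h1, h2⟩ := h
    obtain ⟨h1', h2'⟩ := h'
    rcases lt_or_gt_of_ne hne with hlt | hlt
    · have := h2' c (by omega) (by omega) hne
      simp only at h1 this
      omega
    · have := h2 c' (by omega) (by omega) hne.symm
      simp only at h1' this
      omega
  have hnull : ∀ c ∈ Finset.Ico (M * (j + 1)) (M * (j + 2)),
      NullMeasurableSet {ω | Isolated M w (fun i => ξ i ω) c} Pr :=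
    fun c _ => nullMeasurableSet_isolated hlaw M w c
  have hnull' : NullMeasurableSet {ω | WindowHit M w j fun i => ξ i ω} Pr := by
    rw [hset]; exact Finset.nullMeasurableSet_biUnion _ hnull
  have hint : ∫ ω, hit M w j (fun i => ξ i ω) ∂Pr = Pr.real {ω | WindowHit M w j fun i => ξ i ω} := by
    have : (fun ω => hit M w j fun i => ξ i ω) =
        Set.indicator {ω | WindowHit M w j fun i => ξ i ω} fun _ => (1 : ℝ) := by
      ext ω
      by_cases h : WindowHit M w j fun i => ξ i ω <;> simp [hit, h]
    rw [this, integral_indicator₀ hnull']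
    simp
  rw [hint, hset, measureReal_biUnion_finset₀ hdisj hnull, Finset.sum_congr rfl fun c hc =>
    measureReal_isolated hind hlaw ((Nat.le_mul_of_pos_right M j.succ_pos).trans
      (Finset.mem_Ico.1 hc).1), Finset.sum_const, Nat.card_Ico, nsmul_eq_mul]
  have e2 : M * (j + 2) - M * (j + 1) = M := by
    have : M * (j + 2) = M * (j + 1) + M := by ring
    omega
  rw [e2]

lemma sum_range_three_mul (f : ℕ → ℝ) (n : ℕ) : ∑ j ∈ Finset.range (3 * n), f j =
    ∑ r ∈ Finset.range 3, ∑ q ∈ Finset.range n, f (r + 3 * q) := by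
  induction n with
  | zero => simp
  | succ n ih =>
    rw [Nat.mul_succ, Finset.sum_range_succ, Finset.sum_range_succ, Finset.sum_range_succ, ih]
    simp only [Finset.sum_range_succ, Finset.sum_range_zero]
    ring_nf

/-- The lower tail of the number of windows that are hit. -/
lemma sum_hit_le_le [IsProbabilityMeasure Pr] (hind : iIndepFun ξ Pr)
    (hlaw : ∀ i, HasLaw (ξ i) (poissonMeasure ρ) Pr) {M w : ℕ} (hw : w ≤ M) {p : ℝ}
    (hp : p = M * (ρ * Real.exp (-ρ) * Real.exp (-(ρ * (M + w))))) {θ : ℝ} (hθ : 0 ≤ θ) (n : ℕ) :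
    Pr.real {ω | ∑ j ∈ Finset.range (3 * n), hit M w j (fun i => ξ i ω) ≤
        (1 - θ) * (3 * n * p)} ≤ 3 * Real.exp (-(n * p * (θ ^ 2 / 2))) := by
  have hp0 : 0 ≤ p := by rw [hp]; positivity
  have hclass : ∀ r, Pr.real {ω | ∑ q ∈ Finset.range n, hit M w (r + 3 * q) (fun i => ξ i ω) ≤
      (1 - θ) * (n * p)} ≤ Real.exp (-(n * p * (θ ^ 2 / 2))) := fun r => by
    refine sum_le_le_of_blocks (F := fun q => hit M w (r + 3 * q)) (W := 3 * M) (o := M * r) hind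
      (fun i => (hlaw i).aemeasurable) (fun q => ?_) (fun q x => hit_eq_zero_or_one _ _ _ _) hp0
      (fun q => hp ▸ le_integral_hit hind hlaw _) hθ n
    have e1 : M * r + 3 * M * q = M * (r + 3 * q) := by ring
    have e2 : M * r + 3 * M * (q + 1) = M * (r + 3 * q + 3) := by ring
    rw [e1, e2]
    exact dependsOn_hit hw
  -- If the total over `3n` windows is small, so is the total over one of the three residue classes
  -- modulo three, within which the hits are independent.
  have hsub : {ω | ∑ j ∈ Finset.range (3 * n), hit M w j (fun i => ξ i ω) ≤
      (1 - θ) * (3 * n * p)} ⊆ ⋃ r ∈ Finset.range 3,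
      {ω | ∑ q ∈ Finset.range n, hit M w (r + 3 * q) (fun i => ξ i ω) ≤ (1 - θ) * (n * p)} := by
    intro ω hω
    simp only [Set.mem_ofPred_eq, sum_range_three_mul] at hω
    by_contra hcon
    simp only [Set.mem_iUnion, Set.mem_ofPred_eq, not_exists, not_le] at hcon
    have := Finset.sum_lt_sum_of_nonempty (by simp) hcon
    simp only [Finset.sum_const, Finset.card_range, nsmul_eq_mul] at this
    push_cast at this
    linarith
  refine (measureReal_mono hsub (measure_ne_top _ _)).trans ((measureReal_biUnion_finset_le _ _).trans ?_)
  refine (Finset.sum_le_sum fun r _ => hclass r).trans ?_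
  simp

end Isolated

/-! ### Isolated cells yield laggers and loners. -/

namespace BlockTree

lemma numHonest_add (B : BlockTree) {a b c : ℝ} (hab : a ≤ b) (hbc : b ≤ c) :
    B.numHonest a c = B.numHonest a b + B.numHonest b c := by
  rw [numHonest, numHonest, numHonest,
    ← Set.ncard_union_eq ?_ (B.finite_mined _ _ _) (B.finite_mined _ _ _)]
  · congr 1
    ext k
    simp only [Set.mem_ofPred_eq, Set.mem_union]
    constructor
    · rintro ⟨h1, h2, h3⟩
      rcases le_or_gt (B.T k) b with h | h
      · exact Or.inl ⟨h1, h2, h⟩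
      · exact Or.inr ⟨h1, h, h3⟩
    · rintro (⟨h1, h2, h3⟩ | ⟨h1, h2, h3⟩)
      · exact ⟨h1, h2, h3.trans hbc⟩
      · exact ⟨h1, hab.trans_lt h2, h3⟩
  · exact Set.disjoint_left.2 fun k hk hk' => absurd hk.2.2 (not_le.2 hk'.2.1)

lemma exists_cell {τ : ℕ → ℝ} {i n : ℕ} {x : ℝ} (h : τ i < x) (h' : x ≤ τ (i + n)) :
    ∃ j, i ≤ j ∧ j < i + n ∧ τ j < x ∧ x ≤ τ (j + 1) := by
  induction n with
  | zero => exact absurd h' (not_le.2 h)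
  | succ n ih =>
    rcases le_or_gt x (τ (i + n)) with hx | hx
    · obtain ⟨j, h1, h2, h3⟩ := ih hx
      exact ⟨j, h1, by omega, h3⟩
    · exact ⟨i + n, by omega, by omega, hx, h'⟩

variable {B : BlockTree} {τ : ℕ → ℝ} {M w : ℕ}

lemma exists_honest_of_isolated {c : ℕ}
    (h : Isolated M w (fun c => B.numHonest (τ c) (τ (c + 1))) c) (hc : M ≤ c) :
    ∃ k, B.honest k ∧ τ c < B.T k ∧ B.T k ≤ τ (c + 1) ∧
      ∀ i, B.honest i → τ (c - M) < B.T i → B.T i ≤ τ (c + 1 + w) → i = k := by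
  obtain ⟨k, hk⟩ := Set.ncard_eq_one.1 h.1
  have hkm : k ∈ {k : ℕ | B.honest k ∧ τ c < B.T k ∧ B.T k ≤ τ (c + 1)} := by rw [hk]; rfl
  refine ⟨k, hkm.1, hkm.2.1, hkm.2.2, fun i hi h1 h2 => ?_⟩
  obtain ⟨j, hj1, hj2, hj3, hj4⟩ := exists_cell (n := M + 1 + w) h1
    (by rwa [show c - M + (M + 1 + w) = c + 1 + w by omega])
  rcases eq_or_ne j c with rfl | hne
  · have : i ∈ {k : ℕ | B.honest k ∧ τ j < B.T k ∧ B.T k ≤ τ (j + 1)} := ⟨hi, hj3, hj4⟩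
    rw [hk] at this
    exact this
  · have h0 := (Set.ncard_eq_zero (B.finite_mined _ _ _)).1 (h.2 j (by omega) (by omega) hne)
    have : i ∈ {k : ℕ | B.honest k ∧ τ j < B.T k ∧ B.T k ≤ τ (j + 1)} := ⟨hi, hj3, hj4⟩
    rw [h0] at this
    exact absurd this (Set.notMem_empty _)

/-- Windows that are hit contain distinct blocks with property `Q`. -/
lemma sum_hit_le_ncard (hτ : Monotone τ) {Q : ℕ → Prop}
    (hQ : ∀ k c, M ≤ c → B.honest k → τ c < B.T k → B.T k ≤ τ (c + 1) →
      (∀ i, B.honest i → τ (c - M) < B.T i → B.T i ≤ τ (c + 1 + w) → i = k) → Q k)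
    (N : ℕ) {a b : ℝ} (ha : a ≤ τ 0) (hb : τ (M * (N + 1)) ≤ b) :
    ∑ j ∈ Finset.range N, hit M w j (fun c => B.numHonest (τ c) (τ (c + 1))) ≤
      {k | Q k ∧ a < B.T k ∧ B.T k ≤ b}.ncard := by
  classical
  set x : ℕ → ℕ := fun c => B.numHonest (τ c) (τ (c + 1)) with hx
  have hex : ∀ j, WindowHit M w j x → ∃ k, Q k ∧ τ (M * (j + 1)) < B.T k ∧
      B.T k ≤ τ (M * (j + 2)) := by
    rintro j ⟨c, h1, h2, h3⟩
    have hMc : M ≤ c := (Nat.le_mul_of_pos_right M j.succ_pos).trans h1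
    obtain ⟨k, hk1, hk2, hk3, hk4⟩ := exists_honest_of_isolated h3 hMc
    exact ⟨k, hQ k c hMc hk1 hk2 hk3 hk4, (hτ h1).trans_lt hk2, hk3.trans (hτ h2)⟩
  choose! f hfQ hf1 hf2 using hex
  have hsum : ∑ j ∈ Finset.range N, hit M w j x =
      (((Finset.range N).filter fun j => WindowHit M w j x : Finset ℕ) : Set ℕ).ncard := by
    rw [Set.ncard_coe_finset]
    simp only [hit, Finset.sum_boole]
  rw [hsum]
  have hmem : ∀ j, j ∈ (((Finset.range N).filter fun j => WindowHit M w j x : Finset ℕ) : Set ℕ) →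
      j < N ∧ WindowHit M w j x := fun j hj => by simpa using hj
  have hlt : ∀ i j, i < j → WindowHit M w i x → WindowHit M w j x → f i ≠ f j := by
    intro i j hij hi hj heq
    have h1 := hf2 i hi
    have h2 := hf1 j hj
    -- Distinct windows occupy disjoint time intervals, so the chosen blocks differ.
    have h3 : τ (M * (i + 2)) ≤ τ (M * (j + 1)) := hτ (Nat.mul_le_mul_left M (by omega))
    rw [heq] at h1
    linarith
  refine Nat.cast_le.2 (Set.ncard_le_ncard_of_injOn f (fun j hj => ?_) (fun i hi j hj hij => ?_)
    (B.finite_mined _ _ _))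
  · obtain ⟨hjN, hj⟩ := hmem j hj
    exact ⟨hfQ j hj, (ha.trans (hτ (Nat.zero_le _))).trans_lt (hf1 j hj),
      (hf2 j hj).trans ((hτ (Nat.mul_le_mul_left M (by omega))).trans hb)⟩
  · by_contra hne
    rcases lt_or_gt_of_ne hne with h | h
    · exact hlt i j h (hmem i hi).2 (hmem j hj).2 hij
    · exact hlt j i h (hmem j hj).2 (hmem i hi).2 hij.symm

/-- The boundaries of the cells of length `Δ / M` that start at `a`. -/
noncomputable def cell (a Δ : ℝ) (M c : ℕ) : ℝ := a + c * (Δ / M)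

lemma cell_mono {a Δ : ℝ} (hΔ : 0 < Δ) (M : ℕ) : Monotone (cell a Δ M) := by
  intro c c' h
  unfold cell
  gcongr

lemma cell_add {a Δ : ℝ} {M : ℕ} (hM : 0 < M) (c : ℕ) :
    cell a Δ M (c + M) = cell a Δ M c + Δ := by
  unfold cell
  push_cast
  field_simp
  ring

lemma cell_mul {a Δ : ℝ} {M : ℕ} (hM : 0 < M) (c : ℕ) : cell a Δ M (M * c) = a + c * Δ := by
  unfold cell
  push_cast
  field_simp

/-- The `M` empty cells before an isolated one cover a full time `Δ`. The first `M` cells after `a`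
belong to no window and serve only as this look-back, hence `N + 1` rather than `N`. -/
lemma sum_hit_le_numLaggers (B : BlockTree) {a b Δ : ℝ} (hΔ : 0 < Δ) (hM : 0 < M) {N : ℕ}
    (hN : a + (N + 1) * Δ ≤ b) :
    ∑ j ∈ Finset.range N,
        hit M 0 j (fun c => B.numHonest (cell a Δ M c) (cell a Δ M (c + 1))) ≤
      B.numLaggers Δ a b := by
  refine sum_hit_le_ncard (cell_mono hΔ M) (fun k c hc hk h1 h2 h => ⟨hk, fun i hi h3 h4 => ?_⟩) N
    (by simp [cell]) (by rw [cell_mul hM]; push_cast; exact hN)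
  refine h i hi ?_ (h4.trans h2)
  have := cell_add (a := a) (Δ := Δ) hM (c - M)
  rw [Nat.sub_add_cancel hc] at this
  linarith

lemma sum_hit_le_numLoners (B : BlockTree) {a b Δ : ℝ} (hΔ : 0 < Δ) (hM : 0 < M) {N : ℕ}
    (hN : a + (N + 1) * Δ ≤ b) :
    ∑ j ∈ Finset.range N,
        hit M M j (fun c => B.numHonest (cell a Δ M c) (cell a Δ M (c + 1))) ≤
      B.numLoners Δ a b := by
  refine sum_hit_le_ncard (cell_mono hΔ M)
    (fun k c hc hk h1 h2 h => ⟨⟨hk, fun i hi h3 h4 => ?_⟩, fun i hi h3 h4 => ?_⟩) N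
    (by simp [cell]) (by rw [cell_mul hM]; push_cast; exact hN)
  · refine h i hi ?_ ((h4.trans h2).trans (cell_mono hΔ M (Nat.le_add_right _ _)))
    have := cell_add (a := a) (Δ := Δ) hM (c - M)
    rw [Nat.sub_add_cancel hc] at this
    linarith
  · refine h i hi ((cell_mono hΔ M (Nat.sub_le c M)).trans_lt (h1.trans_le h3)) ?_
    rw [cell_add hM]
    linarith

end BlockTree

/-! ### Tail bounds for the five block counts. -/

section Tails

open BlockTree

variable {Ω : Type*} [MeasurableSpace Ω] {Pr : Measure Ω} {B : Ω → BlockTree} {α Δ δ : ℝ}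

lemma eta_le {α Δ δ : ℝ} (hα : 0 < α) (hΔ : 0 < Δ) : eta α Δ δ ≤ δ ^ 2 * α := by
  have h0 := discount_pos α Δ
  have h1 := discount_lt_one hα hΔ
  have : discount α Δ ^ 2 ≤ 1 := pow_le_one₀ h0.le h1.le
  rw [eta]
  calc δ ^ 2 * discount α Δ ^ 2 * α ≤ δ ^ 2 * 1 * α := by gcongr
    _ = _ := by ring

lemma hasLaw_numHonest (hP : IsPoissonProcess α (fun t ω => (B ω).numHonest 0 t) Pr) {s t : ℝ}
    (hs : 0 ≤ s) (hst : s ≤ t) :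
    HasLaw (fun ω => (B ω).numHonest s t) (poissonMeasure (Real.toNNReal (α * (t - s)))) Pr := by
  have h : HasLaw (fun ω => (B ω).numHonest 0 t - (B ω).numHonest 0 s)
      (poissonMeasure (Real.toNNReal (α * (t - s)))) Pr :=
    hP.law ⟨s, hs⟩ ⟨t, hs.trans hst⟩ hst
  have e : ∀ ω, (B ω).numHonest 0 t - (B ω).numHonest 0 s = (B ω).numHonest s t := fun ω => by
    rw [(B ω).numHonest_add hs hst, Nat.add_sub_cancel_left]
  simpa only [e] using h

lemma iIndepFun_numHonest (hP : IsPoissonProcess α (fun t ω => (B ω).numHonest 0 t) Pr)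
    {τ : ℕ → ℝ} (hτ : Monotone τ) (h0 : ∀ c, 0 ≤ τ c) :
    iIndepFun (fun c ω => (B ω).numHonest (τ c) (τ (c + 1))) Pr := by
  have h : iIndepFun (fun c ω => (B ω).numHonest 0 (τ (c + 1)) - (B ω).numHonest 0 (τ c)) Pr :=
    hP.indep.nat (t := fun c => (⟨τ c, h0 c⟩ : ℝ≥0)) fun c c' hc => hτ hc
  have e : ∀ c ω, (B ω).numHonest 0 (τ (c + 1)) - (B ω).numHonest 0 (τ c) =
      (B ω).numHonest (τ c) (τ (c + 1)) := fun c ω => by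
    rw [(B ω).numHonest_add (h0 c) (hτ (Nat.le_add_right c 1)), Nat.add_sub_cancel_left]
  simpa only [e] using h

lemma measureReal_numHonest (hP : IsPoissonProcess α (fun t ω => (B ω).numHonest 0 t) Pr) {s t : ℝ}
    (hs : 0 ≤ s) (hst : s ≤ t) (p : ℕ → Prop) :
    Pr.real {ω | p ((B ω).numHonest s t)} =
      (poissonMeasure (Real.toNNReal (α * (t - s)))).real {n | p n} := by
  rw [measureReal_def, measureReal_def, (hasLaw_numHonest hP hs hst).measure_eq .of_discrete]

/-- The upper tail of a Poisson variable whose mean is at most `ν (l + 2)`. -/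
lemma poissonMeasure_upper_tail {r : ℝ≥0} {ν γ δ l : ℝ} (hr : r ≤ ν * (l + 2)) (hν : ν ≤ γ)
    (hγ : 0 ≤ γ) (hδ : 0 < δ) (hδ1 : δ ≤ 1) (hl : 78 ≤ δ * l) :
    (poissonMeasure r).real {n | l * (ν + γ * δ) ≤ n} ≤ Real.exp (-(δ ^ 2 * γ / 27 * l)) := by
  refine (poissonMeasure_ge_le r _ (θ := δ / 2) (by linarith) (by linarith)).trans ?_
  rw [Real.exp_le_exp]
  have h1 : (r : ℝ) * (δ / 2 + (δ / 2) ^ 2) ≤ ν * (l + 2) * (δ / 2 + (δ / 2) ^ 2) :=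
    mul_le_mul_of_nonneg_right hr (by positivity)
  have hl0 : 0 < l := by
    by_contra h
    nlinarith
  have h2 : ν * (δ + (l + 2) * (δ / 2) ^ 2) ≤ γ * (δ + (l + 2) * (δ / 2) ^ 2) :=
    mul_le_mul_of_nonneg_right hν (by positivity)
  have h3 : δ + (l + 2) * (δ / 2) ^ 2 - δ / 2 * l * δ ≤ -(δ ^ 2 / 27 * l) := by
    have : δ * 78 ≤ δ * (δ * l) := mul_le_mul_of_nonneg_left hl hδ.le
    nlinarith
  have h4 := mul_le_mul_of_nonneg_left h3 hγ
  linarith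

/-- The threshold uses `l + 2` although the mean uses `l`, leaving room for rounding both endpoints
to a unit grid; `78 ≤ δ l` absorbs the excess. -/
lemma poissonMeasure_lower_tail {r : ℝ≥0} {α δ l : ℝ} (hr : r = α * l) (hα : 0 ≤ α) (hδ : 0 < δ)
    (hl : 78 ≤ δ * l) :
    (poissonMeasure r).real {n | (n : ℝ) ≤ (1 - δ) * (l + 2) * α} ≤
      Real.exp (-(δ ^ 2 * α / 27 * l)) := by
  refine (poissonMeasure_le_le r _ hδ.le).trans ?_
  rw [Real.exp_le_exp, hr]
  have h3 : δ * ((1 - δ) * (l + 2)) - l * (δ - δ ^ 2 / 2) ≤ -(δ ^ 2 / 27 * l) := by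
    have : δ * 78 ≤ δ * (δ * l) := mul_le_mul_of_nonneg_left hl hδ.le
    nlinarith
  have h4 := mul_le_mul_of_nonneg_left h3 hα
  linarith

lemma measureReal_numHonest_ge [IsProbabilityMeasure Pr]
    (hP : IsPoissonProcess α (fun t ω => (B ω).numHonest 0 t) Pr) (hα : 0 < α) (hΔ : 0 < Δ)
    (hδ : 0 < δ) (hδ1 : δ ≤ 1) {a b l : ℝ} (ha : 0 ≤ a) (hab : a ≤ b) (hl : 78 ≤ δ * l)
    (hbl : b - a ≤ l + 2) :
    Pr.real {ω | (1 + δ) * l * α ≤ (B ω).numHonest a b} ≤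
      Real.exp (-(eta α Δ δ / 27 * l)) := by
  have hl0 : 0 < l := by by_contra h; nlinarith
  rw [measureReal_numHonest hP ha hab fun n => (1 + δ) * l * α ≤ n]
  have h := poissonMeasure_upper_tail (r := Real.toNNReal (α * (b - a))) (ν := α) (γ := α)
    (by rw [Real.coe_toNNReal _ (mul_nonneg hα.le (by linarith))]; gcongr) le_rfl hα.le hδ hδ1 hl
  rw [show l * (α + α * δ) = (1 + δ) * l * α by ring] at h
  refine h.trans (Real.exp_le_exp.2 ?_)
  have := eta_le (δ := δ) hα hΔ
  gcongr

lemma measureReal_numHonest_le [IsProbabilityMeasure Pr]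
    (hP : IsPoissonProcess α (fun t ω => (B ω).numHonest 0 t) Pr) (hα : 0 < α) (hΔ : 0 < Δ)
    (hδ : 0 < δ) {a b : ℝ} (ha : 0 ≤ a) (hl : 78 ≤ δ * (b - a)) :
    Pr.real {ω | (B ω).numHonest a b ≤ (1 - δ) * (b - a + 2) * α} ≤
      Real.exp (-(eta α Δ δ / 27 * (b - a))) := by
  have hl0 : 0 < b - a := by by_contra h; nlinarith
  rw [measureReal_numHonest hP ha (by linarith) fun n => (n : ℝ) ≤ (1 - δ) * (b - a + 2) * α]
  refine (poissonMeasure_lower_tail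
    (Real.coe_toNNReal _ (mul_nonneg hα.le hl0.le)) hα.le hδ hl).trans (Real.exp_le_exp.2 ?_)
  have := eta_le (δ := δ) hα hΔ
  gcongr

/-- The lower tail of a count that is at least the number of windows hit, for laggers (`e = 0`) and
for loners (`e = 1`). -/
lemma measureReal_count_le [IsProbabilityMeasure Pr]
    (hP : IsPoissonProcess α (fun t ω => (B ω).numHonest 0 t) Pr) (hα : 0 < α) (hΔ : 0 < Δ)
    (hδ : 0 < δ) (hδ' : δ < 40 / 81) {a b : ℝ} (ha : 0 ≤ a) (hl : 78 * (1 + Δ) ≤ δ * (b - a))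
    {e : ℕ} (he : e ≤ 1) {X : Ω → ℕ}
    (hX : ∀ ω, ∀ M N : ℕ, 0 < M → a + (N + 1) * Δ ≤ b → ∑ j ∈ Finset.range N,
        hit M (e * M) j (fun c => (B ω).numHonest (cell a Δ M c) (cell a Δ M (c + 1))) ≤ X ω) :
    Pr.real {ω | (X ω : ℝ) ≤ (1 - δ) * (b - a + 2) * (discount α Δ ^ (1 + e) * α)} ≤
      3 * Real.exp (-(eta α Δ δ / 27 * (b - a))) := by
  set l := b - a with hl_def
  set g := discount α Δ with hg
  have hg0 : 0 < g := discount_pos α Δ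
  have hg1 : g < 1 := discount_lt_one hα hΔ
  have hl1 : 156 * (1 + Δ) ≤ l := by
    have : 0 < l := by by_contra h; nlinarith
    nlinarith
  -- The mesh is fine enough that the mean `ρ` of one cell is at most `δ / 10`, so the
  -- discretisation loses only the factor `e^{-ρ} ≥ 1 - δ / 10`.
  obtain ⟨M, hM⟩ := exists_nat_gt (10 * (α * Δ) / δ)
  have hM0' : (0 : ℝ) < M := lt_of_le_of_lt (by positivity) hM
  have hM0 : 0 < M := by exact_mod_cast hM0'
  set ρ : ℝ≥0 := Real.toNNReal (α * (Δ / M)) with hρ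
  have hρv : (ρ : ℝ) = α * (Δ / M) := Real.coe_toNNReal _ (by positivity)
  have hρδ : (ρ : ℝ) ≤ δ / 10 := by
    rw [hρv]
    rw [div_lt_iff₀ hδ] at hM
    rw [← mul_div_assoc, div_le_iff₀ hM0']
    linarith
  have hexpρ : 1 - δ / 10 ≤ Real.exp (-ρ) := by
    have := Real.add_one_le_exp (-(ρ : ℝ))
    linarith
  set D := g ^ (1 + e) * α with hD
  have hD0 : 0 < D := by positivity
  have hDg : g ^ 2 * α ≤ D :=
    mul_le_mul_of_nonneg_right (pow_le_pow_of_le_one hg0.le hg1.le (by omega)) hα.le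
  -- The largest number of triples of windows that fit after the initial look-back of length `Δ`.
  set n := ⌊(l - Δ) / (3 * Δ)⌋₊ with hn
  have hn1 : 3 * n * Δ ≤ l - Δ := by
    have h := Nat.floor_le (a := (l - Δ) / (3 * Δ)) (div_nonneg (by linarith) (by positivity))
    rw [← hn, le_div_iff₀ (by positivity)] at h
    linarith
  have hn2 : l - 4 * Δ ≤ 3 * n * Δ := by
    have h := Nat.lt_floor_add_one ((l - Δ) / (3 * Δ))
    rw [← hn, div_lt_iff₀ (by positivity)] at h
    linarith
  set p := M * (ρ * Real.exp (-ρ) * Real.exp (-(ρ * (M + (e * M : ℕ))))) with hp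
  have hpD : p = Δ * Real.exp (-ρ) * D := by
    have h1 : Real.exp (-(ρ * (M + (e * M : ℕ)))) = g ^ (1 + e) := by
      rw [hg, discount, ← Real.exp_nat_mul, hρv]
      congr 1
      push_cast
      field_simp
    rw [hp, h1, hρv, hD]
    have : (M : ℝ) * (Δ / M) = Δ := by field_simp
    calc _ = (M * (Δ / M)) * α * Real.exp (-(α * (Δ / M))) * g ^ (1 + e) := by ring
      _ = _ := by rw [this]; ring
  set y := Real.exp (-ρ) * (3 * n * Δ) with hy
  have hyp : 3 * n * p = y * D := by rw [hpD, hy]; ring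
  have hy1 : (1 - δ / 10) * (l - 4 * Δ) ≤ y :=
    mul_le_mul hexpρ hn2 (by linarith) (Real.exp_pos _).le
  have hcell : ∀ c, 0 ≤ cell a Δ M c := fun c => by unfold cell; positivity
  have hlaw : ∀ c, HasLaw (fun ω => (B ω).numHonest (cell a Δ M c) (cell a Δ M (c + 1)))
      (poissonMeasure ρ) Pr := fun c => by
    have h := hasLaw_numHonest hP (hcell c) (cell_mono hΔ M c.le_succ)
    have e1 : cell a Δ M (c.succ) - cell a Δ M c = Δ / M := by
      unfold cell; push_cast; ring
    rw [e1] at h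
    exact h
  -- Deviation `2δ/3` leaves the rest of `δ` for the discretisation loss and the boundary terms.
  -- Together with `y ≥ l / 2` it gives `(n p)(2δ/3)²/2 = (2/27) δ² y D ≥ η l / 27`, the source of
  -- the constant 27.
  have hmain := sum_hit_le_le (iIndepFun_numHonest hP (cell_mono hΔ M) hcell) hlaw
    (w := e * M) (M := M) (by nlinarith) hp (θ := 2 / 3 * δ) (by linarith) n
  have hsub : {ω | (X ω : ℝ) ≤ (1 - δ) * (l + 2) * D} ⊆ {ω | ∑ j ∈ Finset.range (3 * n),
      hit M (e * M) j (fun c => (B ω).numHonest (cell a Δ M c) (cell a Δ M (c + 1))) ≤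
        (1 - 2 / 3 * δ) * (3 * n * p)} := by
    intro ω hω
    refine (hX ω M (3 * n) hM0 (by push_cast; linarith)).trans (le_trans hω ?_)
    rw [hyp, ← mul_assoc (1 - 2 / 3 * δ) y D]
    refine mul_le_mul_of_nonneg_right ?_ hD0.le
    have h1 : (1 - 2 / 3 * δ) * ((1 - δ / 10) * (l - 4 * Δ)) ≤ (1 - 2 / 3 * δ) * y :=
      mul_le_mul_of_nonneg_left hy1 (by linarith)
    refine le_trans ?_ h1
    have h2 : 0 ≤ δ ^ 2 * (l - 4 * Δ) := mul_nonneg (sq_nonneg _) (by linarith)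
    nlinarith
  refine (measureReal_mono hsub (measure_ne_top _ _)).trans (hmain.trans ?_)
  refine mul_le_mul_of_nonneg_left (Real.exp_le_exp.2 (neg_le_neg ?_)) (by norm_num)
  have h1 : n * p * ((2 / 3 * δ) ^ 2 / 2) = 2 / 27 * δ ^ 2 * (y * D) := by
    rw [← hyp]; ring
  have h2 : l / 2 ≤ y := by nlinarith
  have h3 : l / 2 * (g ^ 2 * α) ≤ y * D :=
    mul_le_mul h2 hDg (by positivity) (by linarith)
  have h4 := mul_le_mul_of_nonneg_left h3 (by positivity : 0 ≤ 2 / 27 * δ ^ 2)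
  rw [h1, eta, ← hg]
  linarith

lemma measureReal_numLaggers_le [IsProbabilityMeasure Pr]
    (hP : IsPoissonProcess α (fun t ω => (B ω).numHonest 0 t) Pr) (hα : 0 < α) (hΔ : 0 < Δ)
    (hδ : 0 < δ) (hδ' : δ < 40 / 81) {a b : ℝ} (ha : 0 ≤ a) (hl : 78 * (1 + Δ) ≤ δ * (b - a)) :
    Pr.real {ω | (B ω).numLaggers Δ a b ≤ (1 - δ) * (b - a + 2) * (discount α Δ * α)} ≤
      3 * Real.exp (-(eta α Δ δ / 27 * (b - a))) := by
  have h := measureReal_count_le hP hα hΔ hδ hδ' ha hl (e := 0) (by norm_num)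
    (X := fun ω => (B ω).numLaggers Δ a b) fun ω M N hM hN => by
      simpa using (B ω).sum_hit_le_numLaggers hΔ hM hN
  simpa using h

lemma measureReal_numLoners_le [IsProbabilityMeasure Pr]
    (hP : IsPoissonProcess α (fun t ω => (B ω).numHonest 0 t) Pr) (hα : 0 < α) (hΔ : 0 < Δ)
    (hδ : 0 < δ) (hδ' : δ < 40 / 81) {a b : ℝ} (ha : 0 ≤ a) (hl : 78 * (1 + Δ) ≤ δ * (b - a)) :
    Pr.real {ω | (B ω).numLoners Δ a b ≤ (1 - δ) * (b - a + 2) * (discount α Δ ^ 2 * α)} ≤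
      3 * Real.exp (-(eta α Δ δ / 27 * (b - a))) :=
  measureReal_count_le hP hα hΔ hδ hδ' ha hl (e := 1) le_rfl
    (X := fun ω => (B ω).numLoners Δ a b) fun ω M N hM hN => by
      rw [one_mul]; exact (B ω).sum_hit_le_numLoners hΔ hM hN

/-- The number of adversarial blocks is dominated by Poisson variables of mean `β (t - s)`. -/
def AdversaryDominated (β : ℝ) (B : Ω → BlockTree) (Pr : Measure Ω) : Prop :=
  ∀ s t : ℝ, 0 ≤ s → s < t → ∀ n : ℕ,
    Real.exp (-(β * (t - s))) * ∑ i ∈ Finset.range (n + 1), (β * (t - s)) ^ i / i.factorial ≤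
      Pr.real {ω | (B ω).numAdversarial s t ≤ n}

/-- The count is at most `n` exactly when every finite set of qualifying blocks has at most `n`
elements, a countable intersection of measurable conditions. -/
lemma measurableSet_numAdversarial_le (hT : ∀ k, Measurable fun ω => (B ω).T k)
    (hh : ∀ k, MeasurableSet {ω | (B ω).honest k}) (s t : ℝ) (n : ℕ) :
    MeasurableSet {ω | (B ω).numAdversarial s t ≤ n} := by
  have hset : {ω | (B ω).numAdversarial s t ≤ n} = ⋂ F : Finset ℕ,
      {ω | (∀ k ∈ F, ¬ (B ω).honest k ∧ s < (B ω).T k ∧ (B ω).T k ≤ t) → F.card ≤ n} := by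
    ext ω
    simp only [Set.mem_iInter, Set.mem_ofPred_eq]
    constructor
    · intro h F hF
      rw [← Set.ncard_coe_finset]
      exact (Set.ncard_le_ncard (fun k hk => hF k hk) ((B ω).finite_mined _ s t)).trans h
    · intro h
      have hfin := (B ω).finite_mined (fun k => ¬ (B ω).honest k) s t
      have := h hfin.toFinset fun k hk => by simpa using hk
      rwa [← Set.ncard_eq_toFinset_card _ hfin] at this
  rw [hset]
  refine MeasurableSet.iInter fun F => ?_
  by_cases hF : F.card ≤ n
  · simp [hF]
  · simp only [hF, imp_false]
    refine MeasurableSet.compl ?_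
    have : {ω | ∀ k ∈ F, ¬ (B ω).honest k ∧ s < (B ω).T k ∧ (B ω).T k ≤ t} =
        ⋂ k ∈ F, ({ω | (B ω).honest k}ᶜ ∩ ({ω | s < (B ω).T k} ∩ {ω | (B ω).T k ≤ t})) := by
      ext ω; simp
    change MeasurableSet {ω | ∀ k ∈ F, ¬ (B ω).honest k ∧ s < (B ω).T k ∧ (B ω).T k ≤ t}
    rw [this]
    exact Finset.measurableSet_biInter _ fun k _ => (hh k).compl.inter
      ((measurableSet_lt measurable_const (hT k)).inter (measurableSet_le (hT k) measurable_const))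

lemma measureReal_numAdversarial_ge_le [IsProbabilityMeasure Pr] {β : ℝ} (hβ : 0 ≤ β)
    (hT : ∀ k, Measurable fun ω => (B ω).T k) (hh : ∀ k, MeasurableSet {ω | (B ω).honest k})
    (hZ : AdversaryDominated β B Pr) {s t y : ℝ} (hs : 0 ≤ s) (hst : s < t) (hy : 0 < y) :
    Pr.real {ω | y ≤ (B ω).numAdversarial s t} ≤
      (poissonMeasure (Real.toNNReal (β * (t - s)))).real {n | y ≤ n} := by
  -- The largest integer below `y`; positivity of `y` keeps the natural subtraction from truncating.
  set n := ⌈y⌉₊ - 1 with hn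
  have hy1 : 0 < ⌈y⌉₊ := Nat.ceil_pos.2 hy
  have hiff : ∀ z : ℕ, y ≤ z ↔ ¬ z ≤ n := fun z => by rw [← Nat.ceil_le]; omega
  have e1 : {ω | y ≤ (B ω).numAdversarial s t} = {ω | (B ω).numAdversarial s t ≤ n}ᶜ := by
    ext ω; simp only [Set.mem_ofPred_eq, Set.mem_compl_iff]; exact hiff _
  have e2 : {z : ℕ | y ≤ z} = ((Finset.range (n + 1) : Finset ℕ) : Set ℕ)ᶜ := by
    ext z
    simp only [Set.mem_ofPred_eq, Set.mem_compl_iff, Finset.coe_range, Set.mem_Iio,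
      Order.lt_add_one_iff]
    exact hiff z
  rw [e1, e2, probReal_compl_eq_one_sub (measurableSet_numAdversarial_le hT hh s t n),
    probReal_compl_eq_one_sub .of_discrete, ← sum_measureReal_singleton]
  refine sub_le_sub_left (le_trans (le_of_eq ?_) (hZ s t hs hst n)) 1
  rw [Finset.mul_sum]
  refine Finset.sum_congr rfl fun i _ => ?_
  rw [poissonMeasure_real_singleton,
    Real.coe_toNNReal _ (mul_nonneg hβ (sub_nonneg.2 hst.le)), mul_div_assoc]

lemma measureReal_numAdversarial_ge [IsProbabilityMeasure Pr] {β : ℝ} (hβ : 0 ≤ β)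
    (hT : ∀ k, Measurable fun ω => (B ω).T k) (hh : ∀ k, MeasurableSet {ω | (B ω).honest k})
    (hZ : AdversaryDominated β B Pr) (hα : 0 < α) (hδ : 0 < δ) (hδ1 : δ ≤ 1)
    (hβα : β ≤ discount α Δ ^ 2 * α) {a b l : ℝ} (ha : 0 ≤ a) (hab : a < b) (hl : 78 ≤ δ * l)
    (hbl : b - a ≤ l + 2) :
    Pr.real {ω | l * β + l * discount α Δ ^ 2 * α * δ ≤ (B ω).numAdversarial a b} ≤
      Real.exp (-(eta α Δ δ / 27 * l)) := by
  have hl0 : 0 < l := by by_contra h; nlinarith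
  have hg0 := discount_pos α Δ
  refine (measureReal_numAdversarial_ge_le hβ hT hh hZ ha hab (by positivity)).trans ?_
  have h := poissonMeasure_upper_tail (r := Real.toNNReal (β * (b - a))) (ν := β)
    (γ := discount α Δ ^ 2 * α)
    (by rw [Real.coe_toNNReal _ (mul_nonneg hβ (by linarith))]; gcongr) hβα (by positivity) hδ hδ1 hl
  rw [show l * (β + discount α Δ ^ 2 * α * δ) = l * β + l * discount α Δ ^ 2 * α * δ by ring,
    ← mul_assoc] at h
  exact h

end Tails

/-! ### From fixed intervals to all intervals: union bound over a unit grid. -/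

namespace BlockTree

lemma ncard_mined_mono (B : BlockTree) (p : ℕ → Prop) {a a' b b' : ℝ} (ha : a' ≤ a) (hb : b ≤ b') :
    {k | p k ∧ a < B.T k ∧ B.T k ≤ b}.ncard ≤ {k | p k ∧ a' < B.T k ∧ B.T k ≤ b'}.ncard :=
  Set.ncard_le_ncard (fun _ hk => ⟨hk.1, ha.trans_lt hk.2.1, hk.2.2.trans hb⟩)
    (B.finite_mined _ _ _)

/-- One of the counts is atypical on an interval of length `l`, up to an error of `1` at both
ends. -/
def Atypical (B : BlockTree) (α β Δ δ a b a' b' l : ℝ) : Prop :=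
  (1 + δ) * l * α ≤ B.numHonest a' b' ∨
  B.numHonest a b ≤ (1 - δ) * (l + 2) * α ∨
  B.numLaggers Δ a b ≤ (1 - δ) * (l + 2) * (discount α Δ * α) ∨
  B.numLoners Δ a b ≤ (1 - δ) * (l + 2) * (discount α Δ ^ 2 * α) ∨
  l * β + l * discount α Δ ^ 2 * α * δ ≤ B.numAdversarial a' b'

/-- `Atypical` on the cell `(i, j)` of the grid of mesh `1` around `(s, u]`. -/
def AtypicalCell (B : BlockTree) (α β Δ δ s u : ℝ) (i j : ℕ) : Prop :=
  i ≤ s ∧ B.Atypical α β Δ δ (s - i) (u + j) (max 0 (s - i - 1)) (u + j + 1) (u + j - (s - i))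

/-- Counts increase with the interval: lower bounds come from the inner interval and upper bounds
from the outer one. The `+ 2` in the thresholds pays for the difference in length. -/
lemma good_of_not_atypical {B : BlockTree} {α β Δ δ a b a₁ b₁ a₂ b₂ : ℝ} (hα : 0 < α)
    (hβ : 0 ≤ β) (hδ : 0 < δ) (hδ1 : δ ≤ 1) (h : ¬ B.Atypical α β Δ δ a₁ b₁ a₂ b₂ (b₁ - a₁))
    (ha₁ : a ≤ a₁) (hb₁ : b₁ ≤ b) (ha₂ : a₂ ≤ a) (hb₂ : b ≤ b₂) (hl : b - a ≤ b₁ - a₁ + 2) :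
    B.Good α β Δ δ a b := by
  simp only [Atypical, not_or, not_le] at h
  obtain ⟨h1, h2, h3, h4, h5⟩ := h
  have hg0 := discount_pos α Δ
  have hδ0 : 0 ≤ 1 - δ := by linarith
  have hl' : b₁ - a₁ ≤ b - a := by linarith
  refine ⟨⟨?_, ?_⟩, ?_, ?_, ?_⟩
  · refine lt_of_le_of_lt ?_ (h2.trans_le (Nat.cast_le.2 (B.ncard_mined_mono _ ha₁ hb₁)))
    gcongr
  · refine (Nat.cast_le.2 (B.ncard_mined_mono _ ha₂ hb₂)).trans_lt (h1.trans_le ?_)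
    gcongr
  · refine lt_of_le_of_lt ?_ (h3.trans_le (Nat.cast_le.2 (B.ncard_mined_mono _ ha₁ hb₁)))
    rw [mul_assoc]
    gcongr
  · refine lt_of_le_of_lt ?_ (h4.trans_le (Nat.cast_le.2 (B.ncard_mined_mono _ ha₁ hb₁)))
    rw [mul_assoc]
    gcongr
  · refine (Nat.cast_le.2 (B.ncard_mined_mono _ ha₂ hb₂)).trans_lt (h5.trans_le ?_)
    gcongr

lemma exists_atypicalCell {B : BlockTree} {α β Δ δ s u : ℝ} (hα : 0 < α) (hβ : 0 ≤ β)
    (hδ : 0 < δ) (hδ1 : δ ≤ 1) (h : ¬ B.Typical α β Δ δ s u) :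
    ∃ i j, B.AtypicalCell α β Δ δ s u i j := by
  contrapose! h
  intro a b ha has hub
  have hi := Nat.floor_le (sub_nonneg.2 has)
  have hi' := Nat.lt_floor_add_one (s - a)
  have hj := Nat.floor_le (sub_nonneg.2 hub)
  have hj' := Nat.lt_floor_add_one (b - u)
  have h1 := h ⌊s - a⌋₊ ⌊b - u⌋₊
  simp only [AtypicalCell, not_and] at h1
  exact good_of_not_atypical hα hβ hδ hδ1 (h1 (by linarith)) (by linarith) (by linarith)
    (max_le ha (by linarith)) (by linarith) (by linarith)

end BlockTree

open BlockTree

variable {Ω : Type*} [MeasurableSpace Ω] {Pr : Measure Ω} [IsProbabilityMeasure Pr]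
  {B : Ω → BlockTree} {α β Δ δ : ℝ}

lemma eta_pos (hα : 0 < α) (hδ : 0 < δ) : 0 < eta α Δ δ := by
  have := discount_pos α Δ
  unfold eta
  positivity

lemma measureReal_atypicalCell_le (hα : 0 < α) (hβ : 0 ≤ β) (hΔ : 0 < Δ) (hδ : 0 < δ)
    (hδ' : δ < 40 / 81) (hβα : β ≤ discount α Δ ^ 2 * α)
    (hP : IsPoissonProcess α (fun t ω => (B ω).numHonest 0 t) Pr)
    (hT : ∀ k, Measurable fun ω => (B ω).T k) (hh : ∀ k, MeasurableSet {ω | (B ω).honest k})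
    (hZ : AdversaryDominated β B Pr) {s u : ℝ} (hL : 78 * (1 + Δ) ≤ δ * (u - s)) (i j : ℕ) :
    Pr.real {ω | (B ω).AtypicalCell α β Δ δ s u i j} ≤
      9 * Real.exp (-(eta α Δ δ / 27 * (u - s + i + j))) := by
  by_cases hi : (i : ℝ) ≤ s
  swap
  · simp only [AtypicalCell, hi, false_and, Set.ofPred_false, measureReal_empty]
    positivity
  have hi0 : (0 : ℝ) ≤ i := i.cast_nonneg
  have hj0 : (0 : ℝ) ≤ j := j.cast_nonneg
  have hsu : s < u := by by_contra h; nlinarith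
  set a := s - i with ha
  set b := u + j with hb
  set a' := max 0 (a - 1) with ha'
  have ha0 : 0 ≤ a := sub_nonneg.2 hi
  have hl : u - s + i + j = b - a := by rw [ha, hb]; ring
  have hl1 : 78 * (1 + Δ) ≤ δ * (b - a) := by
    rw [← hl]
    nlinarith [mul_nonneg hδ.le hi0, mul_nonneg hδ.le hj0]
  have hl2 : 78 ≤ δ * (b - a) := by linarith
  have hab' : a' < b + 1 := max_lt (by linarith) (by linarith)
  have hbl : b + 1 - a' ≤ b - a + 2 := by linarith [le_max_right 0 (a - 1)]
  have hδ1 : δ ≤ 1 := by linarith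
  set x := Real.exp (-(eta α Δ δ / 27 * (b - a))) with hx
  have hsub : {ω | (B ω).AtypicalCell α β Δ δ s u i j} ⊆
      {ω | (1 + δ) * (b - a) * α ≤ (B ω).numHonest a' (b + 1)} ∪
      ({ω | (B ω).numHonest a b ≤ (1 - δ) * (b - a + 2) * α} ∪
      ({ω | (B ω).numLaggers Δ a b ≤ (1 - δ) * (b - a + 2) * (discount α Δ * α)} ∪
      ({ω | (B ω).numLoners Δ a b ≤ (1 - δ) * (b - a + 2) * (discount α Δ ^ 2 * α)} ∪
      {ω | (b - a) * β + (b - a) * discount α Δ ^ 2 * α * δ ≤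
        (B ω).numAdversarial a' (b + 1)}))) := fun ω hω => hω.2
  refine (measureReal_mono hsub (measure_ne_top _ _)).trans ?_
  rw [hl]
  have h1 := measureReal_numHonest_ge hP hα hΔ hδ hδ1 (le_max_left 0 (a - 1)) hab'.le hl2 hbl
  have h2 := measureReal_numHonest_le hP hα hΔ hδ ha0 hl2
  have h3 := measureReal_numLaggers_le hP hα hΔ hδ hδ' ha0 hl1
  have h4 := measureReal_numLoners_le hP hα hΔ hδ hδ' ha0 hl1
  have h5 := measureReal_numAdversarial_ge hβ hT hh hZ hα hδ hδ1 hβα (le_max_left 0 (a - 1)) hab'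
    hl2 hbl
  -- The factor 9 is `1 + 1 + 3 + 3 + 1`; laggers and loners cost 3 each because of the residue
  -- classes.
  refine (measureReal_union_le _ _).trans ((add_le_add h1 ((measureReal_union_le _ _).trans
    (add_le_add h2 ((measureReal_union_le _ _).trans (add_le_add h3
      ((measureReal_union_le _ _).trans (add_le_add h4 h5))))))).trans (le_of_eq ?_))
  ring

lemma measure_not_typical_le (hα : 0 < α) (hβ : 0 ≤ β) (hΔ : 0 < Δ) (hδ : 0 < δ)
    (hδ' : δ < 40 / 81) (hβα : β ≤ discount α Δ ^ 2 * α)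
    (hP : IsPoissonProcess α (fun t ω => (B ω).numHonest 0 t) Pr)
    (hT : ∀ k, Measurable fun ω => (B ω).T k) (hh : ∀ k, MeasurableSet {ω | (B ω).honest k})
    (hZ : AdversaryDominated β B Pr) {s u : ℝ} (hL : 78 * (1 + Δ) ≤ δ * (u - s)) :
    Pr.real {ω | ¬ (B ω).Typical α β Δ δ s u} ≤
      mu α Δ δ * Real.exp (-(eta α Δ δ / 27 * (u - s))) := by
  have hη := eta_pos (Δ := Δ) hα hδ
  set κ := eta α Δ δ / 27 with hκ
  set x := Real.exp (-κ) with hx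
  set c := 9 * Real.exp (-(κ * (u - s))) with hc
  have hx0 : 0 ≤ x := (Real.exp_pos _).le
  have hx1 : x < 1 := Real.exp_lt_one_iff.2 (by rw [hκ]; linarith)
  have hgeo := hasSum_geometric_of_lt_one hx0 hx1
  have hbound : ∀ ij : ℕ × ℕ, Pr.real {ω | (B ω).AtypicalCell α β Δ δ s u ij.1 ij.2} ≤
      c * (x ^ ij.1 * x ^ ij.2) := fun ij => by
    refine (measureReal_atypicalCell_le hα hβ hΔ hδ hδ' hβα hP hT hh hZ hL ij.1 ij.2).trans
      (le_of_eq ?_)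
    rw [hc, hx, ← Real.exp_nat_mul, ← Real.exp_nat_mul, mul_assoc, ← Real.exp_add, ← Real.exp_add]
    congr 2
    rw [hκ]
    ring
  have hsum : HasSum (fun ij : ℕ × ℕ => c * (x ^ ij.1 * x ^ ij.2))
      (c * ((1 - x)⁻¹ * (1 - x)⁻¹)) :=
    (hgeo.mul hgeo (hgeo.summable.mul_of_nonneg hgeo.summable (fun n => pow_nonneg hx0 n)
      fun n => pow_nonneg hx0 n)).mul_left c
  have hsub : {ω | ¬ (B ω).Typical α β Δ δ s u} ⊆
      ⋃ ij : ℕ × ℕ, {ω | (B ω).AtypicalCell α β Δ δ s u ij.1 ij.2} := fun ω hω => by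
    obtain ⟨i, j, hij⟩ := exists_atypicalCell hα hβ hδ (by linarith) hω
    exact Set.mem_iUnion.2 ⟨(i, j), hij⟩
  have hc0 : 0 ≤ c := by positivity
  have hle : Pr {ω | ¬ (B ω).Typical α β Δ δ s u} ≤
      ENNReal.ofReal (c * ((1 - x)⁻¹ * (1 - x)⁻¹)) := by
    refine (measure_mono hsub).trans ((measure_iUnion_le _).trans ?_)
    rw [← hsum.tsum_eq, ENNReal.ofReal_tsum_of_nonneg (fun ij => by positivity) hsum.summable]
    refine ENNReal.tsum_le_tsum fun ij => ?_
    rw [← ofReal_measureReal (measure_ne_top _ _)]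
    exact ENNReal.ofReal_le_ofReal (hbound ij)
  have hx1' : 0 < 1 - x := sub_pos.2 hx1
  refine (ENNReal.toReal_le_of_le_ofReal (by positivity) hle).trans ?_
  have hexp : Real.exp (-(1 / 27 * eta α Δ δ)) = x := by rw [hx, hκ]; ring_nf
  -- The factor `e^{2η/27}` in `mu` is slack here.
  have h1 : 1 ≤ Real.exp (2 / 27 * eta α Δ δ) := Real.one_le_exp (by positivity)
  rw [mu, hexp, hc]
  calc _ = 9 * 1 / (1 - x) ^ 2 * Real.exp (-(κ * (u - s))) := by field_simp
    _ ≤ _ := by gcongr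

end Prism

open Prism in
theorem mainTheorem5 {Ω : Type*} [MeasurableSpace Ω] (Pr : Measure Ω) [IsProbabilityMeasure Pr]
    (m : ℕ) (hm : 1 ≤ m) (α β Δ δ : ℝ) (hα : 1 / 2 < α) (hβ : 0 ≤ β) (hΔ : 0 < Δ)
    (hδ : 0 < δ) (hδ' : δ < 40 / 81)
    (hαβ : β < (1 - 81 / 40 * δ) * Prism.discount α Δ ^ 2 * α)
    (S : Ω → Prism.Execution m Δ) (hS : Prism.IsPrismModel α β S Pr)
    (k : ℕ) (hk : 160 * α * (1 + Δ) / δ ≤ k) (h : ℕ) (hh : 1 ≤ h) (t : ℝ) :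
    (∀ ω ∈ Prism.typicalEvent S α β δ k t,
      ((S ω).tree 0).firstPublication h +
          ((k / ((1 - 41 / 40 * δ) * (1 - Prism.discount α Δ) * Prism.discount α Δ * α) + Δ : ℝ) :
            EReal) ≤ (t : EReal) →
        (S ω).CommonPermanentPrefix t h) ∧
    ∃ A : Set Ω, MeasurableSet A ∧ A ⊆ Prism.typicalEvent S α β δ k t ∧
      1 - m * Prism.mu α Δ δ *
          Real.exp (-(Prism.eta α Δ δ / 27 * (k / (2 * α) - 2 * Δ))) ≤ Pr.real A ∧
      ∀ ω ∈ A,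
        ((S ω).tree 0).firstPublication h +
            ((k / ((1 - 41 / 40 * δ) * (1 - Prism.discount α Δ) * Prism.discount α Δ * α) + Δ :
              ℝ) : EReal) ≤ (t : EReal) →
          (S ω).CommonPermanentPrefix t h := by
  have hα0 : 0 < α := by linarith
  have hdet : ∀ ω ∈ typicalEvent S α β δ k t,
      ((S ω).tree 0).firstPublication h +
          ((k / ((1 - 41 / 40 * δ) * (1 - discount α Δ) * discount α Δ * α) + Δ : ℝ) :
            EReal) ≤ (t : EReal) → (S ω).CommonPermanentPrefix t h := fun ω hω hR =>
    commonPermanentPrefix_of_typical hm hα hΔ hδ hδ' hαβ (S ω) hk hω hR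
  refine ⟨hdet, ?_⟩
  -- Typicality quantifies over uncountably many intervals, so measurability of `bad` is not
  -- claimed; the complement of its measurable hull serves as `A`, with no loss of probability.
  set bad : Set Ω := ⋃ j ∈ (Finset.univ : Finset (Fin m)),
    {ω | ¬ ((S ω).tree j.succ).Typical α β Δ δ (t - k / (2 * α) + Δ) (t - Δ)} with hbad
  have hA : (toMeasurable Pr bad)ᶜ ⊆ typicalEvent S α β δ k t := fun ω hω j => by
    by_contra hj
    exact hω (subset_toMeasurable Pr bad (Set.mem_biUnion (Finset.mem_coe.2 (Finset.mem_univ j)) hj))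
  refine ⟨(toMeasurable Pr bad)ᶜ, (measurableSet_toMeasurable _ _).compl, hA, ?_,
    fun ω hω => hdet ω (hA hω)⟩
  have hβα : β ≤ discount α Δ ^ 2 * α := by
    have : 0 < discount α Δ ^ 2 * α := mul_pos (pow_pos (discount_pos α Δ) 2) hα0
    nlinarith
  have hlen : t - Δ - (t - k / (2 * α) + Δ) = k / (2 * α) - 2 * Δ := by ring
  have hprob_tree : ∀ j : Fin m, Pr.real
      {ω | ¬ ((S ω).tree j.succ).Typical α β Δ δ (t - k / (2 * α) + Δ) (t - Δ)} ≤
        mu α Δ δ * Real.exp (-(eta α Δ δ / 27 * (k / (2 * α) - 2 * Δ))) := fun j => by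
    rw [← hlen]
    exact measure_not_typical_le (B := fun ω => (S ω).tree j.succ) hα0 hβ hΔ hδ hδ' hβα
      (hS.poisson j.succ) (hS.measurable_T j.succ) (hS.measurableSet_honest j.succ)
      (hS.dominated j.succ) (by rw [hlen]; exact window_length hα hΔ hδ hδ' hk)
  have hprob : Pr.real bad ≤
      m * (mu α Δ δ * Real.exp (-(eta α Δ δ / 27 * (k / (2 * α) - 2 * Δ)))) := by
    refine (measureReal_biUnion_finset_le _ _).trans
      ((Finset.sum_le_sum fun j _ => hprob_tree j).trans (le_of_eq ?_))
    rw [Finset.sum_const, Finset.card_univ, Fintype.card_fin, nsmul_eq_mul]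
  rw [probReal_compl_eq_one_sub (measurableSet_toMeasurable _ _), measureReal_def,
    measure_toMeasurable, ← measureReal_def]
  linarith
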